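/- Let $E$ be a real vector space and let $N$, $M$ be finite geometric simplicial complexes in $E$ such that $M$ is a subdivision of $N$: $|M|=|N|$, and every simplex of $M$ is contained in a simplex of $N$. For $K=N,M$ let $C_k(K)$ ($k\ge 0$) be the space of simplicial $k$-chains with real coefficients, with basis the $k$-simplices of $K$, each oriented by the increasing order of its vertices for a fixed total order on $E$, and let $\partial_{k}\colon C_{k}(K)\to C_{k-1}(K)$ be the simplicial boundary map ($\partial_0=0$). Let $i_*\colon C_k(N)\to C_k(M)$ be the induced map, which sends a $k$-simplex $\sigma$ of $N$ to the sum of the $k$-simplices of $M$ contained in $\sigma$, oriented coherently with $\sigma$. An inner product on $C_*(K)$ means an inner product on every $C_k(K)$. If $p$ is an inner product on $C_*(K)$, write $\partial^*_k\colon C_{k-1}(K)\to C_{k}(K)$ for the $p$-adjoint of $\partial_k$, and $$\square_p=\partial_{k}^*\partial_{k}+\partial_{k+1}\partial_{k+1}^*\quad\text{on } C_k(K)$$ for the Laplacian. Let $h$ and $g$ be inner products on $C_*(N)$ and $C_*(M)$. There is exactly one family of subspaces $V_k\subseteq C_k(M)$, $k\ge 0$, with $$V_k=\bigl(i_*C_k(N)+\partial_{k+1}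 V_{k+1}\bigr)^{\perp_g}\qquad\text{for all }k,$$ and there is exactly one inner product $g'$ on $C_*(M)$ (the canonical inner product) such that, for every $k$, the subspaces $i_*C_k(N)$, $\partial_{k+1} V_{k+1}$ and $V_k$ are mutually $g'$-orthogonal, $g'$ agrees with $g$ on $\partial_{k+1} V_{k+1}$ and on $V_k$, and $g'(i_*x,i_*y)=h(x,y)$ for all $x,y\in C_k(N)$. This $g'$ satisfies, in every degree, $$i_*\circ\square_h=\square_{g'}\circ i_*.$$ -/

import Mathlib

namespace SubdivisionHarmonic

/-- `M` is a subdivision of `N`: the two complexes have the same underlying space and every simplex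
of `M` is contained in a simplex of `N`. -/
structure IsSubdivision {E : Type*} [AddCommGroup E] [Module ℝ E]
    (N M : Geometry.SimplicialComplex ℝ E) : Prop where
  space_eq : M.space = N.space
  refines : ∀ τ ∈ M.faces, ∃ σ ∈ N.faces,
    convexHull ℝ (τ : Set E) ⊆ convexHull ℝ (σ : Set E)

section Chains

variable {E : Type*} [AddCommGroup E] [Module ℝ E] [LinearOrder E]

/-- The `k`-simplices of a simplicial complex. -/
abbrev Simplex (K : Geometry.SimplicialComplex ℝ E) (k : ℕ) : Type _ :=
  {s : Finset E // s ∈ K.faces ∧ s.card = k + 1}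

instance instFiniteSimplex (K : Geometry.SimplicialComplex ℝ E) [hK : Finite K.faces] (k : ℕ) :
    Finite (Simplex K k) :=
  Finite.of_injective (fun s : Simplex K k => (⟨s.1, s.2.1⟩ : K.faces))
    (fun _ _ h => Subtype.ext (congrArg (fun t : K.faces => t.1) h))

/-- The space `C_k(K)` of simplicial `k`-chains with real coefficients. Its basis consists of the
`k`-simplices, each oriented by the order of its vertices. -/
abbrev Chain (K : Geometry.SimplicialComplex ℝ E) (k : ℕ) : Type _ := Simplex K k →₀ ℝ

/-- The vertices `v_0 < ... < v_k` of a `k`-simplex in increasing order. -/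
def Simplex.vertex {K : Geometry.SimplicialComplex ℝ E} {k : ℕ} (s : Simplex K k)
    (i : Fin (k + 1)) : E :=
  s.1.orderEmbOfFin s.2.2 i

/-- The face opposite to the `i`-th vertex. -/
def Simplex.face {K : Geometry.SimplicialComplex ℝ E} {k : ℕ} (s : Simplex K (k + 1))
    (i : Fin (k + 2)) : Simplex K k :=
  ⟨s.1.erase (s.vertex i), by
    have hc : (s.1.erase (s.vertex i)).card = k + 1 := by
      rw [Finset.card_erase_of_mem (show s.vertex i ∈ s.1 from s.1.orderEmbOfFin_mem s.2.2 i), s.2.2]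
      rfl
    refine ⟨K.down_closed s.2.1 (Finset.erase_subset _ _) ?_, hc⟩
    rw [← Finset.card_pos, hc]
    exact Nat.succ_pos k⟩

/-- The boundary map `∂_{k+1} : C_{k+1}(K) → C_k(K)`,
`∂[v_0, ..., v_{k+1}] = ∑ (-1)^i [v_0, ..., v_{i-1}, v_{i+1}, ..., v_{k+1}]`. -/
noncomputable def boundary (K : Geometry.SimplicialComplex ℝ E) (k : ℕ) :
    Chain K (k + 1) →ₗ[ℝ] Chain K k :=
  Finsupp.linearCombination ℝ fun s : Simplex K (k + 1) =>
    ∑ i : Fin (k + 2), (-1 : ℝ) ^ (i : ℕ) • Finsupp.single (s.face i) (1 : ℝ)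

/-- `B` is a matrix of barycentric coordinates, with respect to `v_0, ..., v_k`, of points
`w_0, ..., w_k` of the convex hull of the `v_j`. -/
def IsBarycentricMatrix {k : ℕ} (v w : Fin (k + 1) → E)
    (B : Matrix (Fin (k + 1)) (Fin (k + 1)) ℝ) : Prop :=
  (∀ i j, 0 ≤ B i j) ∧ (∀ i, ∑ j, B i j = 1) ∧ ∀ i, w i = ∑ j, B i j • v j

open Classical in
/-- The coefficient in `i_* σ` of a `k`-simplex `τ` of the subdivision: `0` if `τ` is not contained
in `σ`, and otherwise `1` or `-1` according to whether the orientations of `τ` and `σ` agree, that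
is, according to the sign of the determinant of the barycentric coordinates of the vertices of `τ`
with respect to those of `σ`. -/
noncomputable def orientationSign {N M : Geometry.SimplicialComplex ℝ E} {k : ℕ}
    (σ : Simplex N k) (τ : Simplex M k) : ℝ :=
  if ∃ B, IsBarycentricMatrix σ.vertex τ.vertex B ∧ 0 < B.det then 1
  else if ∃ B, IsBarycentricMatrix σ.vertex τ.vertex B ∧ B.det < 0 then -1
  else 0

/-- The map `i_* : C_k(N) → C_k(M)` induced by a subdivision. It sends a `k`-simplex `σ` of `N` to
the sum of the `k`-simplices of `M` contained in `σ`, oriented coherently with `σ`. -/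
noncomputable def inclusion (N M : Geometry.SimplicialComplex ℝ E) [Finite M.faces] (k : ℕ) :
    Chain N k →ₗ[ℝ] Chain M k :=
  Finsupp.linearCombination ℝ fun σ : Simplex N k =>
    Finsupp.equivFunOnFinite.symm fun τ : Simplex M k => orientationSign σ τ

end Chains

/-- An inner product on a real vector space. -/
@[ext]
structure InnerProd (V : Type*) [AddCommGroup V] [Module ℝ V] where
  form : V →ₗ[ℝ] V →ₗ[ℝ] ℝ
  symm : ∀ x y, form x y = form y x
  pos : ∀ x, x ≠ 0 → 0 < form x x

section Adjoint

variable {V W : Type*} [AddCommGroup V] [Module ℝ V] [AddCommGroup W] [Module ℝ W]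

theorem InnerProd.form_injective (p : InnerProd V) : Function.Injective p.form := by
  refine (injective_iff_map_eq_zero p.form).2 fun x hx => ?_
  by_contra hne
  have := p.pos x hne
  rw [hx] at this
  exact lt_irrefl _ this

/-- The isomorphism `V ≃ V*` given by an inner product on a finite-dimensional space. -/
noncomputable def InnerProd.toDual [FiniteDimensional ℝ V] (p : InnerProd V) :
    V ≃ₗ[ℝ] Module.Dual ℝ V :=
  LinearEquiv.ofInjectiveOfFinrankEq p.form p.form_injective Subspace.dual_finrank_eq.symm

/-- The adjoint `T^* : W → V` of `T : V → W` with respect to inner products `p` and `q`. -/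
noncomputable def adjoint [FiniteDimensional ℝ V] (p : InnerProd V) (q : InnerProd W)
    (T : V →ₗ[ℝ] W) : W →ₗ[ℝ] V :=
  p.toDual.symm.toLinearMap ∘ₗ T.dualMap ∘ₗ q.form

/-- The defining property of the adjoint. -/
theorem adjoint_spec [FiniteDimensional ℝ V] (p : InnerProd V) (q : InnerProd W)
    (T : V →ₗ[ℝ] W) (w : W) (v : V) : p.form (adjoint p q T w) v = q.form w (T v) := by
  have h : p.toDual (adjoint p q T w) = T.dualMap (q.form w) := by
    simp [adjoint]
  exact congrArg (fun f : Module.Dual ℝ V => f v) h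

/-- The orthogonal complement of a subspace. -/
def InnerProd.orthogonal (p : InnerProd V) (S : Submodule ℝ V) : Submodule ℝ V where
  carrier := {x | ∀ y ∈ S, p.form x y = 0}
  zero_mem' := by intro y _; simp
  add_mem' := by intro a b ha hb y hy; simp [ha y hy, hb y hy]
  smul_mem' := by intro c a ha y hy; simp [ha y hy]

end Adjoint

section Laplacian

variable {E : Type*} [AddCommGroup E] [Module ℝ E] [LinearOrder E]

/-- An inner product on the graded space `C_*(K)`: one on each chain space. -/
abbrev ChainInner (K : Geometry.SimplicialComplex ℝ E) : Type _ := ∀ k, InnerProd (Chain K k)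

/-- The Laplacian `□_k = ∂_{k+1} ∂_{k+1}^* + ∂_k^* ∂_k` on `C_k(K)`, where `∂_0 = 0`. -/
noncomputable def laplacian (K : Geometry.SimplicialComplex ℝ E) [Finite K.faces]
    (p : ChainInner K) : ∀ k, Chain K k →ₗ[ℝ] Chain K k
  | 0 => boundary K 0 ∘ₗ adjoint (p 1) (p 0) (boundary K 0)
  | k + 1 => boundary K (k + 1) ∘ₗ adjoint (p (k + 2)) (p (k + 1)) (boundary K (k + 1))
      + adjoint (p (k + 1)) (p k) (boundary K k) ∘ₗ boundary K k

/-- The subspaces `V_k` of `C_k(M)` determined, downwards from the top dimension (above it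
`C_k(M) = 0`), by `V_k = (im i_* + ∂ V_{k+1})^⊥` with respect to `g`. -/
def IsComplementFamily (N M : Geometry.SimplicialComplex ℝ E) [Finite M.faces] (g : ChainInner M)
    (V : ∀ k, Submodule ℝ (Chain M k)) : Prop :=
  ∀ k, V k = (g k).orthogonal
    (LinearMap.range (inclusion N M k) ⊔ (V (k + 1)).map (boundary M k))

/-- `g'` is the canonical inner product on `C_*(M)` for `i : (C_*(N), h) → (C_*(M), g)`: the summands
of `C_k(M) = im i_* ⊕ ∂ V_{k+1} ⊕ V_k` are mutually `g'`-orthogonal, `g'` pulls back to `h` along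
`i_*`, and `g'` agrees with `g` on `∂ V_{k+1}` and on `V_k`. -/
structure IsCanonical (N M : Geometry.SimplicialComplex ℝ E) [Finite M.faces]
    (h : ChainInner N) (g : ChainInner M) (V : ∀ k, Submodule ℝ (Chain M k))
    (g' : ChainInner M) : Prop where
  pullback : ∀ k x y, (g' k).form (inclusion N M k x) (inclusion N M k y) = (h k).form x y
  orth_range_boundary : ∀ k, ∀ x ∈ LinearMap.range (inclusion N M k),
    ∀ y ∈ (V (k + 1)).map (boundary M k), (g' k).form x y = 0
  orth_range_compl : ∀ k, ∀ x ∈ LinearMap.range (inclusion N M k), ∀ y ∈ V k,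
    (g' k).form x y = 0
  orth_boundary_compl : ∀ k, ∀ x ∈ (V (k + 1)).map (boundary M k), ∀ y ∈ V k,
    (g' k).form x y = 0
  eq_on_boundary : ∀ k, ∀ x ∈ (V (k + 1)).map (boundary M k),
    ∀ y ∈ (V (k + 1)).map (boundary M k), (g' k).form x y = (g k).form x y
  eq_on_compl : ∀ k, ∀ x ∈ V k, ∀ y ∈ V k, (g' k).form x y = (g k).form x y

end Laplacian

end SubdivisionHarmonic

namespace SubdivisionHarmonic

/-! ### Linear algebra: projections, and inner products prescribed on a direct sum -/

section InnerProd

variable {V X : Type*} [AddCommGroup V] [Module ℝ V] [AddCommGroup X] [Module ℝ X]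

/-! Three facts about $i_*$ reduce the theorem to linear algebra: it is a chain map, it is
injective, and its cokernel is acyclic in positive degrees ($\partial v\in\operatorname{im} i_*$
forces $v\in\operatorname{im} i_*+\operatorname{im}\partial$). The spaces $V_k$ are determined by
downward recursion, since $C_k(M)=0$ for large $k$. If $v\in V_{k+1}$ and $\partial
v\in\operatorname{im} i_*$, acyclicity puts $v$ in $\operatorname{im} i_*+\partial V_{k+2}$, to
which it is orthogonal, so $v=0$. Hence $C_k(M)=\operatorname{im} i_*\oplus\partial V_{k+1}\oplus
V_k$, and $g'$ can be prescribed blockwise. Testing against these summands gives $\partial^*_{g'}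
i_*=i_*\partial^*_h$ (`IsCanonical.adjoint_inclusion`), which together with $\partial
i_*=i_*\partial$ is the assertion on Laplacians (`exists_canonical_of_acyclic_cokernel`).

Chain map (`boundary_inclusion`): let $\rho$ be a $k$-simplex of $M$ inside a $(k+1)$-simplex
$\sigma$ of $N$. The affine function `side` vanishes on $\rho$, and its sign distinguishes the two
sides of $\rho$ in $\sigma$. Each side carries at most one coface of $\rho$ (`eq_of_side_mul_pos`),
and carries one as soon as it contains a point of $\sigma$ (`exists_coface_side_mul_pos`). If $\rho$
lies in no facet of $\sigma$, two cofaces cancel; if it lies in a facet, a single coface remains,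
with the sign of that facet.

Injectivity and acyclicity: sending each point to a vertex of its carrier in $N$ induces a chain map
$a\colon C_*(M)\to C_*(N)$ with $a\,i_*=1$ (`approximation_inclusion`). It remains to see that a
cycle $u$ of positive degree with $a u=0$ bounds in $M$
(`exists_boundary_eq_of_approximation_eq_zero`). In ordered chains, which cones make contractible, a
homotopy inside the simplices of $N$ gives $b$ in $|N|=|M|$ with $\partial b=-u$. Iterated
barycentric subdivision followed by a vertex map of $M$ is a chain map $T$ carrying $b$ into $M$,
and a homotopy inside the simplices of $M$ gives $d$ with $\partial d=Tu-u$. Then $-(Tb+d)$ has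
boundary $u$, and projecting to oriented chains finishes. -/

theorem InnerProd.nonneg (p : InnerProd V) (x : V) : 0 ≤ p.form x x := by
  by_cases hx : x = 0
  · simp [hx]
  · exact (p.pos x hx).le

theorem InnerProd.eq_zero_of_self (p : InnerProd V) {x : V} (hx : p.form x x = 0) : x = 0 := by
  by_contra h
  exact (p.pos x h).ne' hx

theorem InnerProd.ext_left (p : InnerProd V) {x y : V}
    (hxy : ∀ z, p.form x z = p.form y z) : x = y :=
  p.form_injective (LinearMap.ext hxy)

/-- The restriction of an inner product to a subspace. -/
def InnerProd.restrict (p : InnerProd V) (S : Submodule ℝ V) : InnerProd S where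
  form := p.form.compl₁₂ S.subtype S.subtype
  symm x y := p.symm x y
  pos x hx := p.pos x (by simpa using hx)

/-- The adjoint of the inclusion of `S` is the orthogonal projection onto `S`. -/
theorem InnerProd.exists_sub_mem_orthogonal [FiniteDimensional ℝ V] (p : InnerProd V)
    (S : Submodule ℝ V) (x : V) : ∃ s ∈ S, x - s ∈ p.orthogonal S := by
  refine ⟨adjoint (p.restrict S) p S.subtype x, Submodule.coe_mem _, fun y hy => ?_⟩
  have : p.form (adjoint (p.restrict S) p S.subtype x) y = p.form x y :=
    adjoint_spec (p.restrict S) p S.subtype x ⟨y, hy⟩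
  simp [this]

theorem InnerProd.eq_zero_of_mem_orthogonal (p : InnerProd V) {S : Submodule ℝ V} {x : V}
    (hx : x ∈ S) (hx' : x ∈ p.orthogonal S) : x = 0 :=
  p.eq_zero_of_self (hx' x hx)

/-- A vector space split as `i X ⊕ B ⊕ (i X ⊕ B)^⊥` carries an inner product restricting to given
ones on the summands. -/
theorem exists_canonical_innerProd [FiniteDimensional ℝ V] (h : InnerProd X) (g : InnerProd V)
    (i : X →ₗ[ℝ] V) (hi : Function.Injective i) (B S : Submodule ℝ V)
    (hB : Disjoint (LinearMap.range i) B) (hS : S = g.orthogonal (LinearMap.range i ⊔ B)) :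
    ∃ q : InnerProd V, (∀ x y, q.form (i x) (i y) = h.form x y) ∧
      (∀ x, ∀ y ∈ B, q.form (i x) y = 0) ∧ (∀ x, ∀ y ∈ S, q.form (i x) y = 0) ∧
      (∀ x ∈ B, ∀ y ∈ S, q.form x y = 0) ∧ (∀ x ∈ B, ∀ y ∈ B, q.form x y = g.form x y) ∧
      (∀ x ∈ S, ∀ y ∈ S, q.form x y = g.form x y) := by
  let e₀ : (X × B × S) →ₗ[ℝ] V := i.coprod (B.subtype.coprod S.subtype)
  have he : Function.Bijective e₀ := by
    refine ⟨(injective_iff_map_eq_zero e₀).2 ?_, fun v => ?_⟩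
    · rintro ⟨x, ⟨b, hb⟩, ⟨s, hs⟩⟩ h0
      have h0 : i x + (b + s) = 0 := by simpa [e₀] using h0
      have hmem : i x + b ∈ LinearMap.range i ⊔ B :=
        Submodule.add_mem_sup (LinearMap.mem_range_self i x) hb
      have hs0 : s = 0 := by
        refine g.eq_zero_of_mem_orthogonal (S := LinearMap.range i ⊔ B) ?_ (hS ▸ hs)
        have : s = -(i x + b) := by rw [eq_neg_iff_add_eq_zero, ← h0]; abel
        rw [this]
        exact neg_mem hmem
      have hb0 : b = 0 := by
        refine Submodule.disjoint_def.1 hB b ?_ hb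
        have : b = i (-x) := by
          rw [map_neg, eq_neg_iff_add_eq_zero, ← h0, hs0]; abel
        exact this ▸ LinearMap.mem_range_self i _
      have hx0 : x = 0 := hi (by simpa [hs0, hb0] using h0)
      simp [hs0, hb0, hx0]
    · obtain ⟨s, hs, hv⟩ := g.exists_sub_mem_orthogonal (LinearMap.range i ⊔ B) v
      obtain ⟨_, ⟨x, rfl⟩, b, hb, rfl⟩ := Submodule.mem_sup.1 hs
      exact ⟨(x, ⟨b, hb⟩, ⟨v - (i x + b), hS ▸ hv⟩), by simp [e₀, ← add_assoc]⟩
  let e := LinearEquiv.ofBijective e₀ he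
  let r : V →ₗ[ℝ] X × B × S := e.symm.toLinearMap
  have hri : ∀ x, r (i x) = (x, 0, 0) := fun x =>
    (LinearEquiv.symm_apply_eq e).2 (by simp [e, e₀])
  have hrB : ∀ b (hb : b ∈ B), r b = (0, ⟨b, hb⟩, 0) := fun b hb =>
    (LinearEquiv.symm_apply_eq e).2 (by simp [e, e₀])
  have hrS : ∀ s (hs : s ∈ S), r s = (0, 0, ⟨s, hs⟩) := fun s hs =>
    (LinearEquiv.symm_apply_eq e).2 (by simp [e, e₀])
  let pX : V →ₗ[ℝ] X := LinearMap.fst ℝ _ _ ∘ₗ r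
  let pB : V →ₗ[ℝ] V := B.subtype ∘ₗ LinearMap.fst ℝ _ _ ∘ₗ LinearMap.snd ℝ _ _ ∘ₗ r
  let pS : V →ₗ[ℝ] V := S.subtype ∘ₗ LinearMap.snd ℝ _ _ ∘ₗ LinearMap.snd ℝ _ _ ∘ₗ r
  have hp : ∀ v, pX v = 0 → pB v = 0 → pS v = 0 → v = 0 := by
    intro v h1 h2 h3
    apply e.symm.injective
    rw [map_zero]
    exact Prod.ext h1 (Prod.ext (Subtype.ext h2) (Subtype.ext h3))
  let q : InnerProd V :=
    { form := h.form.compl₁₂ pX pX + g.form.compl₁₂ pB pB + g.form.compl₁₂ pS pS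
      symm := fun x y => by
        simp [h.symm (pX x), g.symm (pB x), g.symm (pS x)]
      pos := fun x hx => by
        simp only [LinearMap.add_apply, LinearMap.compl₁₂_apply]
        have h1 := h.nonneg (pX x)
        have h2 := g.nonneg (pB x)
        have h3 := g.nonneg (pS x)
        refine lt_of_le_of_ne (by positivity) fun h0 => hx (hp x ?_ ?_ ?_)
        · exact h.eq_zero_of_self (by linarith)
        · exact g.eq_zero_of_self (by linarith)
        · exact g.eq_zero_of_self (by linarith) }
  refine ⟨q, ?_, ?_, ?_, ?_, ?_, ?_⟩
  · intro x y
    simp [q, pX, pB, pS, hri]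
  · intro x y hy
    simp [q, pX, pB, pS, hri, hrB y hy]
  · intro x y hy
    simp [q, pX, pB, pS, hri, hrS y hy]
  · intro x hx y hy
    simp [q, pX, pB, pS, hrB x hx, hrS y hy]
  · intro x hx y hy
    simp [q, pX, pB, pS, hrB x hx, hrB y hy]
  · intro x hx y hy
    simp [q, pX, pB, pS, hrS x hx, hrS y hy]

end InnerProd

/-! ### The complement family, the canonical inner product, and the reduction to homology -/

section Complement

theorem exists_forall_isEmpty_simplex {E : Type*} [AddCommGroup E] [Module ℝ E]
    (K : Geometry.SimplicialComplex ℝ E) [Finite K.faces] :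
    ∃ n, ∀ k, n ≤ k → IsEmpty (Simplex K k) := by
  obtain ⟨n, hn⟩ := (Set.finite_range fun s : K.faces => s.1.card).bddAbove
  refine ⟨n, fun k hk => ⟨fun s => ?_⟩⟩
  have := hn ⟨⟨s.1, s.2.1⟩, rfl⟩
  have hs := s.2.2
  simp only at this
  omega

variable {E : Type*} [AddCommGroup E] [Module ℝ E] [LinearOrder E]
  {N M : Geometry.SimplicialComplex ℝ E} [Finite M.faces]

theorem exists_isComplementFamily (g : ChainInner M) :
    ∃ V, IsComplementFamily N M g V ∧ ∀ V', IsComplementFamily N M g V' → V' = V := by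
  obtain ⟨n, hn⟩ := exists_forall_isEmpty_simplex M
  have hsub : ∀ k, n ≤ k → ∀ A B : Submodule ℝ (Chain M k), A = B := fun k hk A B => by
    have := hn k hk
    exact Subsingleton.elim A B
  -- `W m` is the `m`-th iterate of the defining recursion, started from `⊥`. Degree `k` uses `m = n
  -- - k`; truncated subtraction gives `m = 0` exactly where the chain space is zero.
  let W : ℕ → ∀ k, Submodule ℝ (Chain M k) := fun m => Nat.rec (fun _ => ⊥)
    (fun _ U k => (g k).orthogonal
      (LinearMap.range (inclusion N M k) ⊔ (U (k + 1)).map (boundary M k))) m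
  refine ⟨fun k => W (n - k) k, fun k => ?_, fun V' hV' => ?_⟩
  · by_cases hk : n ≤ k
    · exact hsub k hk _ _
    · obtain ⟨m, hm⟩ : ∃ m, n - k = m + 1 := ⟨n - k - 1, by omega⟩
      have hm' : n - (k + 1) = m := by omega
      simp only [hm, hm', W]
  · have key : ∀ m k, n - k = m → V' k = W m k := by
      intro m
      induction m with
      | zero => exact fun k hk => hsub k (by omega) _ _
      | succ m ih =>
        intro k hk
        rw [hV' k, ih (k + 1) (by omega)]
    exact funext fun k => key _ k rfl

variable {g : ChainInner M} {V : ∀ k, Submodule ℝ (Chain M k)}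

theorem IsComplementFamily.exists_decomposition (hV : IsComplementFamily N M g V) (k : ℕ)
    (w : Chain M k) : ∃ x, ∃ b ∈ V (k + 1), ∃ s ∈ V k,
      w = inclusion N M k x + boundary M k b + s := by
  obtain ⟨a, ha, hw⟩ := (g k).exists_sub_mem_orthogonal
    (LinearMap.range (inclusion N M k) ⊔ (V (k + 1)).map (boundary M k)) w
  obtain ⟨_, ⟨x, rfl⟩, _, ⟨b, hb, rfl⟩, rfl⟩ := Submodule.mem_sup.1 ha
  exact ⟨x, b, hb, _, (hV k) ▸ hw, by simp⟩

variable {h : ChainInner N} {g' : ChainInner M}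

/-- The defining conditions evaluate the form on any two decomposed vectors, so only the existence
of decompositions matters, not their uniqueness. -/
theorem IsCanonical.unique (hV : IsComplementFamily N M g V) (hg' : IsCanonical N M h g V g')
    {g'' : ChainInner M} (hg'' : IsCanonical N M h g V g'') : g'' = g' := by
  have key : ∀ q, IsCanonical N M h g V q → ∀ k x b s x' b' s', b ∈ V (k + 1) → b' ∈ V (k + 1) →
      s ∈ V k → s' ∈ V k → (q k).form (inclusion N M k x + boundary M k b + s)
        (inclusion N M k x' + boundary M k b' + s') = (h k).form x x' +
          (g k).form (boundary M k b) (boundary M k b') + (g k).form s s' := by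
    intro q hq k x b s x' b' s' hb hb' hs hs'
    have mB : ∀ c ∈ V (k + 1), boundary M k c ∈ (V (k + 1)).map (boundary M k) :=
      fun c hc => Submodule.mem_map_of_mem hc
    have mR : ∀ y, inclusion N M k y ∈ LinearMap.range (inclusion N M k) :=
      LinearMap.mem_range_self _
    simp only [map_add, LinearMap.add_apply]
    rw [hq.pullback, hq.orth_range_boundary k _ (mR x) _ (mB b' hb'),
      hq.orth_range_compl k _ (mR x) _ hs', (q k).symm _ (inclusion N M k x'),
      hq.orth_range_boundary k _ (mR x') _ (mB b hb), (q k).symm s (inclusion N M k x'),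
      hq.orth_range_compl k _ (mR x') _ hs, hq.eq_on_boundary k _ (mB b hb) _ (mB b' hb'),
      (q k).symm s (boundary M k b'), hq.orth_boundary_compl k _ (mB b' hb') _ hs,
      hq.orth_boundary_compl k _ (mB b hb) _ hs', hq.eq_on_compl k _ hs _ hs']
    ring
  funext k
  refine InnerProd.ext (LinearMap.ext fun v => LinearMap.ext fun w => ?_)
  obtain ⟨x, b, hb, s, hs, rfl⟩ := hV.exists_decomposition k v
  obtain ⟨x', b', hb', s', hs', rfl⟩ := hV.exists_decomposition k w
  rw [key g'' hg'' k _ _ _ _ _ _ hb hb' hs hs', key g' hg' k _ _ _ _ _ _ hb hb' hs hs']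

/-- Both sides are paired with `i y + ∂ b + s`. The term `∂ b` dies on the left by `∂ ∂ = 0` and on
the right by orthogonality; the term `s` dies on the left because `∂ s` lies in `∂ V_{k+1}`, which
is orthogonal to the image of `i`. What remains is the adjunction for `h`. -/
theorem IsCanonical.adjoint_inclusion [Finite N.faces] (hV : IsComplementFamily N M g V)
    (hg' : IsCanonical N M h g V g')
    (hMM : ∀ k c, boundary M k (boundary M (k + 1) c) = 0)
    (hcomm : ∀ k x, boundary M k (inclusion N M (k + 1) x) = inclusion N M k (boundary N k x))
    (k : ℕ) (x : Chain N k) :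
    adjoint (g' (k + 1)) (g' k) (boundary M k) (inclusion N M k x) =
      inclusion N M (k + 1) (adjoint (h (k + 1)) (h k) (boundary N k) x) := by
  refine (g' (k + 1)).ext_left fun w => ?_
  rw [adjoint_spec]
  obtain ⟨y, b, hb, s, hs, rfl⟩ := hV.exists_decomposition (k + 1) w
  have mB := Submodule.mem_map_of_mem (f := boundary M (k + 1)) hb
  have mS := Submodule.mem_map_of_mem (f := boundary M k) hs
  have mR : ∀ j z, inclusion N M j z ∈ LinearMap.range (inclusion N M j) :=
    fun j z => LinearMap.mem_range_self _ z
  simp only [map_add]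
  rw [hcomm, hMM, hg'.pullback, hg'.pullback, adjoint_spec,
    hg'.orth_range_boundary k _ (mR _ _) _ mS, hg'.orth_range_boundary (k + 1) _ (mR _ _) _ mB,
    hg'.orth_range_compl (k + 1) _ (mR _ _) _ hs]
  simp

/-- The conclusion of the main theorem follows once the inclusion is known to be an injective chain
map whose cokernel has no homology in positive degrees. -/
theorem exists_canonical_of_acyclic_cokernel [Finite N.faces] (h : ChainInner N) (g : ChainInner M)
    (hMM : ∀ k c, boundary M k (boundary M (k + 1) c) = 0)
    (hcomm : ∀ k x, boundary M k (inclusion N M (k + 1) x) = inclusion N M k (boundary N k x))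
    (hinj : ∀ k, Function.Injective (inclusion N M k))
    (hex : ∀ k v x, boundary M k v = inclusion N M k x →
      ∃ y w, v = inclusion N M (k + 1) y + boundary M (k + 1) w) :
    ∃ V : ∀ k, Submodule ℝ (Chain M k),
      IsComplementFamily N M g V ∧
      (∀ V' : ∀ k, Submodule ℝ (Chain M k), IsComplementFamily N M g V' → V' = V) ∧
      ∃ g' : ChainInner M, IsCanonical N M h g V g' ∧
        (∀ g'' : ChainInner M, IsCanonical N M h g V g'' → g'' = g') ∧
        (∀ (k : ℕ) (x y : Chain N k),
          (g' k).form (inclusion N M k x) (inclusion N M k y) = (h k).form x y) ∧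
        (∀ k : ℕ, inclusion N M k ∘ₗ laplacian N h k = laplacian M g' k ∘ₗ inclusion N M k) := by
  obtain ⟨V, hV, hVu⟩ := exists_isComplementFamily (N := N) g
  refine ⟨V, hV, hVu, ?_⟩
  have hdisj : ∀ k, Disjoint (LinearMap.range (inclusion N M k))
      ((V (k + 1)).map (boundary M k)) := by
    intro k
    rw [Submodule.disjoint_def]
    rintro _ ⟨x, rfl⟩ ⟨v, hv, hvx⟩
    obtain ⟨y, w, hw⟩ := hex k v x hvx
    obtain ⟨z, b, hb, s, hs, rfl⟩ := hV.exists_decomposition (k + 2) w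
    -- Splitting `w` as `i z + ∂ b + s` turns `i y + ∂ w` into `i (y + ∂ z) + ∂ s` with `s ∈
    -- V_{k+2}`. So `v` lies in the very subspace to which membership in `V_{k+1}` makes it
    -- orthogonal.
    have hv0 : v = 0 := by
      refine (g (k + 1)).eq_zero_of_mem_orthogonal (x := v) ?_ ((hV (k + 1)) ▸ hv)
      have hv' : v = inclusion N M (k + 1) (y + boundary N (k + 1) z) + boundary M (k + 1) s := by
        rw [hw, map_add, map_add, map_add, hcomm, hMM]
        abel
      rw [hv']
      exact Submodule.add_mem_sup (LinearMap.mem_range_self _ _) (Submodule.mem_map_of_mem hs)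
    rw [← hvx, hv0, map_zero]
  choose q hq using fun k => exists_canonical_innerProd (h k) (g k) (inclusion N M k) (hinj k)
    ((V (k + 1)).map (boundary M k)) (V k) (hdisj k) (hV k)
  have hcan : IsCanonical N M h g V q :=
    { pullback := fun k => (hq k).1
      orth_range_boundary := by
        rintro k _ ⟨x, rfl⟩ y hy
        exact (hq k).2.1 x y hy
      orth_range_compl := by
        rintro k _ ⟨x, rfl⟩ y hy
        exact (hq k).2.2.1 x y hy
      orth_boundary_compl := fun k => (hq k).2.2.2.1
      eq_on_boundary := fun k => (hq k).2.2.2.2.1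
      eq_on_compl := fun k => (hq k).2.2.2.2.2 }
  refine ⟨q, hcan, fun q' hq' => hcan.unique hV hq', hcan.pullback, fun k => ?_⟩
  have hadj := hcan.adjoint_inclusion hV hMM hcomm
  ext1 x
  cases k with
  | zero => exact LinearMap.ext fun r => by simp [laplacian, hadj, hcomm]
  | succ k => exact LinearMap.ext fun r => by simp [laplacian, hadj, hcomm]

end Complement

/-! ### Ordered chains, cones and carried chain homotopies -/

section OrderedChains

/-- Ordered chains: formal linear combinations of `n`-tuples of points. The tuple of length `n` is
an ordered simplex of dimension `n - 1`. -/
abbrev OChain (E : Type*) (n : ℕ) : Type _ := (Fin n → E) →₀ ℝ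

namespace OChain

variable {E : Type*}

/-- The (augmented) boundary of ordered chains. -/
noncomputable def bdry (n : ℕ) : OChain E (n + 1) →ₗ[ℝ] OChain E n :=
  Finsupp.linearCombination ℝ fun x : Fin (n + 1) → E =>
    ∑ i : Fin (n + 1), (-1 : ℝ) ^ (i : ℕ) • Finsupp.single (fun j => x (i.succAbove j)) (1 : ℝ)

theorem bdry_single {n : ℕ} (x : Fin (n + 1) → E) :
    bdry n (Finsupp.single x 1) = ∑ i : Fin (n + 1), (-1 : ℝ) ^ (i : ℕ) •
      Finsupp.single (fun j => x (i.succAbove j)) (1 : ℝ) := by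
  simp [bdry]

/-- The cone over an ordered chain. -/
noncomputable def cone (p : E) (n : ℕ) : OChain E n →ₗ[ℝ] OChain E (n + 1) :=
  Finsupp.lmapDomain ℝ ℝ fun x : Fin n → E => (Fin.cons p x : Fin (n + 1) → E)

theorem cone_single (p : E) {n : ℕ} (x : Fin n → E) (r : ℝ) :
    cone p n (Finsupp.single x r) = Finsupp.single (Fin.cons p x : Fin (n + 1) → E) r := by
  simp [cone]

/-- Length `0` is the augmentation degree, spanned by the empty tuple. This makes coning a
contraction of the whole augmented complex, with no correction term in the lowest degree. -/
theorem bdry_cone_zero (p : E) (c : OChain E 0) : bdry 0 (cone p 0 c) = c := by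
  suffices h : bdry 0 ∘ₗ cone p 0 = LinearMap.id from LinearMap.congr_fun h c
  refine Finsupp.lhom_ext' fun x => LinearMap.ext_ring ?_
  simp only [LinearMap.comp_apply, Finsupp.lsingle_apply, cone_single, bdry_single,
    LinearMap.id_apply]
  rw [Fin.sum_univ_succ]
  simp [Subsingleton.elim (fun _ => _ : Fin 0 → E) x]

theorem bdry_cone (p : E) {n : ℕ} (c : OChain E (n + 1)) :
    bdry (n + 1) (cone p (n + 1) c) = c - cone p n (bdry n c) := by
  suffices h : bdry (n + 1) ∘ₗ cone p (n + 1) = LinearMap.id - cone p n ∘ₗ bdry n from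
    LinearMap.congr_fun h c
  refine Finsupp.lhom_ext' fun x => LinearMap.ext_ring ?_
  simp only [LinearMap.comp_apply, Finsupp.lsingle_apply, cone_single, bdry_single,
    LinearMap.sub_apply, LinearMap.id_apply, map_sum, map_smul]
  rw [Fin.sum_univ_succ, sub_eq_add_neg, ← Finset.sum_neg_distrib]
  congr 1
  · simp
  · refine Finset.sum_congr rfl fun i _ => ?_
    rw [Fin.val_succ, pow_succ, mul_neg_one, neg_smul]
    congr 3
    funext j
    refine Fin.cases ?_ (fun j => ?_) j <;> simp

theorem eq_of_single {n : ℕ} {V : Type*} [AddCommGroup V] [Module ℝ V]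
    {F G : OChain E n →ₗ[ℝ] V} (h : ∀ x, F (Finsupp.single x 1) = G (Finsupp.single x 1)) :
    F = G :=
  Finsupp.lhom_ext' fun x => LinearMap.ext_ring (h x)

/-- Every tuple is the cone from its first vertex over its tail, so the cone formula and induction
replace the pairing of faces with opposite signs. -/
theorem bdry_bdry {n : ℕ} (c : OChain E (n + 2)) : bdry n (bdry (n + 1) c) = 0 := by
  induction n with
  | zero =>
    suffices h : bdry 0 ∘ₗ bdry 1 = (0 : OChain E 2 →ₗ[ℝ] _) from LinearMap.congr_fun h c
    refine eq_of_single fun x => ?_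
    rw [← Fin.cons_self_tail x, ← cone_single, LinearMap.comp_apply, bdry_cone, map_sub,
      bdry_cone_zero, sub_self, LinearMap.zero_apply]
  | succ n ih =>
    suffices h : bdry (n + 1) ∘ₗ bdry (n + 2) = (0 : OChain E (n + 3) →ₗ[ℝ] _) from
      LinearMap.congr_fun h c
    refine eq_of_single fun x => ?_
    rw [← Fin.cons_self_tail x, ← cone_single, LinearMap.comp_apply, bdry_cone, map_sub,
      bdry_cone, ih, map_zero, sub_zero, sub_self, LinearMap.zero_apply]

/-- The map of ordered chains induced by a map of points. -/
noncomputable def push {F : Type*} (v : E → F) (n : ℕ) : OChain E n →ₗ[ℝ] OChain F n :=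
  Finsupp.lmapDomain ℝ ℝ fun x : Fin n → E => fun i => v (x i)

theorem push_single {F : Type*} (v : E → F) {n : ℕ} (x : Fin n → E) (r : ℝ) :
    push v n (Finsupp.single x r) = Finsupp.single (fun i => v (x i)) r := by
  simp [push]

theorem bdry_push {F : Type*} (v : E → F) {n : ℕ} (c : OChain E (n + 1)) :
    bdry n (push v (n + 1) c) = push v n (bdry n c) := by
  suffices h : bdry n ∘ₗ push v (n + 1) = push v n ∘ₗ bdry n from LinearMap.congr_fun h c
  refine eq_of_single fun x => ?_
  simp [push_single, bdry_single]

/-- The ordered chains all of whose vertices lie in `A`. -/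
noncomputable def inSet (A : Set E) (n : ℕ) : Submodule ℝ (OChain E n) :=
  Finsupp.supported ℝ ℝ {x : Fin n → E | ∀ i, x i ∈ A}

theorem inSet_mono {A B : Set E} (h : A ⊆ B) (n : ℕ) : inSet A n ≤ inSet B n :=
  Finsupp.supported_mono fun _ hx i => h (hx i)

theorem single_mem_inSet {A : Set E} {n : ℕ} {x : Fin n → E} (hx : ∀ i, x i ∈ A) (r : ℝ) :
    Finsupp.single x r ∈ inSet A n :=
  Finsupp.single_mem_supported ℝ r hx

/-- A linear map sending the tuples of a set `S` to a submodule sends the chains supported in `S` to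
that submodule. -/
theorem map_mem_of_supported {ι : Type*} {V : Type*} [AddCommGroup V] [Module ℝ V] {S : Set ι}
    {F : (ι →₀ ℝ) →ₗ[ℝ] V} {U : Submodule ℝ V}
    (h : ∀ x ∈ S, F (Finsupp.single x 1) ∈ U) {c : ι →₀ ℝ} (hc : c ∈ Finsupp.supported ℝ ℝ S) :
    F c ∈ U := by
  rw [Finsupp.supported_eq_span_single] at hc
  induction hc using Submodule.span_induction with
  | mem c hc =>
    obtain ⟨x, hx, rfl⟩ := hc
    exact h x hx
  | zero => simp
  | add a b _ _ ha hb => rw [map_add]; exact add_mem ha hb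
  | smul r a _ ha => rw [map_smul]; exact U.smul_mem r ha

theorem map_eq_of_supported {ι : Type*} {V : Type*} [AddCommGroup V] [Module ℝ V] {S : Set ι}
    {F G : (ι →₀ ℝ) →ₗ[ℝ] V} (h : ∀ x ∈ S, F (Finsupp.single x 1) = G (Finsupp.single x 1))
    {c : ι →₀ ℝ} (hc : c ∈ Finsupp.supported ℝ ℝ S) : F c = G c := by
  have := map_mem_of_supported (F := F - G) (U := ⊥) (fun x hx => by simp [h x hx]) hc
  simpa [sub_eq_zero] using this

theorem bdry_mem_inSet {A : Set E} {n : ℕ} {c : OChain E (n + 1)} (hc : c ∈ inSet A (n + 1)) :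
    bdry n c ∈ inSet A n := by
  refine map_mem_of_supported (fun x hx => ?_) hc
  rw [bdry_single]
  exact sum_mem fun i _ => Submodule.smul_mem _ _ (single_mem_inSet (fun j => hx _) 1)

theorem cone_mem_inSet {A : Set E} {n : ℕ} {p : E} (hp : p ∈ A) {c : OChain E n}
    (hc : c ∈ inSet A n) : cone p n c ∈ inSet A (n + 1) := by
  refine map_mem_of_supported (fun x hx => ?_) hc
  rw [cone_single]
  refine single_mem_inSet (fun j => ?_) 1
  refine Fin.cases ?_ (fun j => ?_) j
  · simpa using hp
  · simpa using hx j

theorem push_mem_inSet {A B : Set E} {v : E → E} (h : ∀ x ∈ A, v x ∈ B) {n : ℕ} {c : OChain E n}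
    (hc : c ∈ inSet A n) : push v n c ∈ inSet B n := by
  refine map_mem_of_supported (fun x hx => ?_) hc
  rw [push_single]
  exact single_mem_inSet (fun j => h _ (hx j)) 1

/-- The chain homotopy between two augmentation-preserving chain maps of ordered chains, obtained
by coning off from the first vertex. -/
noncomputable def homotopy (F G : ∀ n, OChain E n →ₗ[ℝ] OChain E n) :
    ∀ n, OChain E n →ₗ[ℝ] OChain E (n + 1)
  | 0 => 0
  | n + 1 => Finsupp.linearCombination ℝ fun x : Fin (n + 1) → E =>
      cone (x 0) (n + 1) (F (n + 1) (Finsupp.single x 1) - G (n + 1) (Finsupp.single x 1) -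
        homotopy F G n (bdry n (Finsupp.single x 1)))

theorem homotopy_single (F G : ∀ n, OChain E n →ₗ[ℝ] OChain E n) {n : ℕ} (x : Fin (n + 1) → E) :
    homotopy F G (n + 1) (Finsupp.single x 1) =
      cone (x 0) (n + 1) (F (n + 1) (Finsupp.single x 1) - G (n + 1) (Finsupp.single x 1) -
        homotopy F G n (bdry n (Finsupp.single x 1))) := by
  simp [homotopy]

section Homotopy

variable {F G : ∀ n, OChain E n →ₗ[ℝ] OChain E n} {A B : Set E}

/-- The cone point is a vertex of the tuple itself, hence in `A ⊆ B`; no convexity is needed, as any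
tuple of points is an ordered simplex. -/
theorem homotopy_mem_inSet (hAB : A ⊆ B) (hF : ∀ n, ∀ c ∈ inSet A n, F n c ∈ inSet B n)
    (hG : ∀ n, ∀ c ∈ inSet A n, G n c ∈ inSet B n) (n : ℕ) {c : OChain E n}
    (hc : c ∈ inSet A n) : homotopy F G n c ∈ inSet B (n + 1) := by
  induction n with
  | zero => simp [homotopy]
  | succ n ih =>
    refine map_mem_of_supported (fun x hx => ?_) hc
    rw [homotopy_single]
    have hs := single_mem_inSet hx 1
    exact cone_mem_inSet (hAB (hx 0))
      (sub_mem (sub_mem (hF _ _ hs) (hG _ _ hs)) (ih (bdry_mem_inSet hs)))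

/-- By the previous degree, `F x - G x - H ∂x` is a cycle, and the cone over a cycle has that cycle
as its boundary. Commutation with the boundary is needed only on chains in `A`, so a map that is a
chain map only simplex by simplex is allowed. -/
theorem bdry_homotopy (h0 : F 0 = G 0)
    (hF : ∀ n, ∀ c ∈ inSet A (n + 1), bdry n (F (n + 1) c) = F n (bdry n c))
    (hG : ∀ n, ∀ c ∈ inSet A (n + 1), bdry n (G (n + 1) c) = G n (bdry n c)) (n : ℕ)
    {c : OChain E (n + 1)} (hc : c ∈ inSet A (n + 1)) :
    bdry (n + 1) (homotopy F G (n + 1) c) =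
      F (n + 1) c - G (n + 1) c - homotopy F G n (bdry n c) := by
  suffices h : (bdry (n + 1) ∘ₗ homotopy F G (n + 1)) c =
      (F (n + 1) - G (n + 1) - homotopy F G n ∘ₗ bdry n) c from h
  induction n with
  | zero =>
    refine map_eq_of_supported (fun x hx => ?_) hc
    have hs := single_mem_inSet hx 1
    rw [LinearMap.comp_apply, homotopy_single, bdry_cone, map_sub (bdry _), map_sub (bdry _),
      hF _ _ hs, hG _ _ hs, h0]
    simp [homotopy]
  | succ n ih =>
    refine map_eq_of_supported (fun x hx => ?_) hc
    have hs := single_mem_inSet hx 1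
    have ih' := ih (bdry_mem_inSet hs)
    simp only [LinearMap.comp_apply, LinearMap.sub_apply, bdry_bdry, map_zero, sub_zero] at ih'
    rw [LinearMap.comp_apply, homotopy_single, bdry_cone, map_sub (bdry _), map_sub (bdry _),
      hF _ _ hs, hG _ _ hs, ih', sub_self, map_zero]
    simp

end Homotopy

end OChain

end OrderedChains

/-! ### Barycentric subdivision of ordered chains -/

section BarycentricSubdivision

namespace OChain

variable {E : Type*} [AddCommGroup E] [Module ℝ E]

/-- Barycentric subdivision of ordered chains. -/
noncomputable def sd : ∀ n, OChain E n →ₗ[ℝ] OChain E n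
  | 0 => LinearMap.id
  | n + 1 => Finsupp.linearCombination ℝ fun x : Fin (n + 1) → E =>
      cone (∑ i, ((n : ℝ) + 1)⁻¹ • x i) n (sd n (bdry n (Finsupp.single x 1)))

theorem sd_single {n : ℕ} (x : Fin (n + 1) → E) :
    sd (n + 1) (Finsupp.single x 1) =
      cone (∑ i, ((n : ℝ) + 1)⁻¹ • x i) n (sd n (bdry n (Finsupp.single x 1))) := by
  simp [sd]

theorem bdry_sd {n : ℕ} (c : OChain E (n + 1)) : bdry n (sd (n + 1) c) = sd n (bdry n c) := by
  suffices h : bdry n ∘ₗ sd (n + 1) = sd (E := E) n ∘ₗ bdry n by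
    rw [← LinearMap.comp_apply, h, LinearMap.comp_apply]
  clear c
  induction n with
  | zero =>
    refine eq_of_single fun x => ?_
    rw [LinearMap.comp_apply, sd_single, bdry_cone_zero]
    rfl
  | succ n ih =>
    refine eq_of_single fun x => ?_
    rw [LinearMap.comp_apply, sd_single, bdry_cone, ← LinearMap.comp_apply (bdry n), ih,
      LinearMap.comp_apply, bdry_bdry, map_zero, map_zero, sub_zero, LinearMap.comp_apply]

theorem barycenter_mem {A : Set E} (hA : Convex ℝ A) {n : ℕ} {x : Fin (n + 1) → E}
    (hx : ∀ i, x i ∈ A) : ∑ i, ((n : ℝ) + 1)⁻¹ • x i ∈ A := by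
  refine hA.sum_mem (fun _ _ => by positivity) ?_ fun i _ => hx i
  simp
  field_simp

theorem sd_mem_inSet {A : Set E} (hA : Convex ℝ A) (n : ℕ) {c : OChain E n}
    (hc : c ∈ inSet A n) : sd n c ∈ inSet A n := by
  induction n with
  | zero => simpa [sd] using hc
  | succ n ih =>
    refine map_mem_of_supported (fun x hx => ?_) hc
    rw [sd_single]
    exact cone_mem_inSet (barycenter_mem hA hx) (ih (bdry_mem_inSet (single_mem_inSet hx 1)))

/-- Iterated barycentric subdivision of ordered chains. -/
noncomputable def sdIter (r n : ℕ) : OChain E n →ₗ[ℝ] OChain E n := (sd n) ^ r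

theorem sdIter_succ (r n : ℕ) (c : OChain E n) : sdIter (r + 1) n c = sd n (sdIter r n c) := by
  simp [sdIter, pow_succ']

theorem sdIter_deg_zero (r : ℕ) : sdIter (E := E) r 0 = LinearMap.id := by
  simp [sdIter, sd, ← Module.End.one_eq_id]

theorem bdry_sdIter (r : ℕ) {n : ℕ} (c : OChain E (n + 1)) :
    bdry n (sdIter r (n + 1) c) = sdIter r n (bdry n c) := by
  induction r with
  | zero => simp [sdIter]
  | succ r ih => rw [sdIter_succ, bdry_sd, ih, sdIter_succ]

theorem sdIter_mem_inSet {A : Set E} (hA : Convex ℝ A) (r n : ℕ) {c : OChain E n}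
    (hc : c ∈ inSet A n) : sdIter r n c ∈ inSet A n := by
  induction r with
  | zero => simpa [sdIter] using hc
  | succ r ih => rw [sdIter_succ]; exact sd_mem_inSet hA n ih

end OChain

end BarycentricSubdivision

/-! ### Barycentric subdivision shrinks the mesh -/

section Mesh

namespace OChain

variable {E : Type*} [NormedAddCommGroup E] [NormedSpace ℝ E]

/-- The tuples of points with pairwise distances at most `d`. -/
def meshLE (E : Type*) [NormedAddCommGroup E] (d : ℝ) (n : ℕ) : Set (Fin n → E) :=
  {x | ∀ i j, dist (x i) (x j) ≤ d}

theorem dist_barycenter_le {d : ℝ} {n m : ℕ} (hn : n + 1 ≤ m) {x : Fin (n + 1) → E}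
    (hx : x ∈ meshLE E d (n + 1)) (i : Fin (n + 1)) :
    dist (x i) (∑ j, ((n : ℝ) + 1)⁻¹ • x j) ≤ (1 - (m : ℝ)⁻¹) * d := by
  have hd : 0 ≤ d := dist_nonneg.trans (hx i i)
  have h1 : x i - ∑ j, ((n : ℝ) + 1)⁻¹ • x j = ∑ j, ((n : ℝ) + 1)⁻¹ • (x i - x j) := by
    simp only [smul_sub, Finset.sum_sub_distrib, Finset.sum_const, Finset.card_univ,
      Fintype.card_fin, ← Nat.cast_smul_eq_nsmul ℝ, smul_smul]
    have : ((n + 1 : ℕ) : ℝ) * ((n : ℝ) + 1)⁻¹ = 1 := by push_cast; field_simp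
    rw [this, one_smul]
  have hterm : ∀ j ∈ Finset.univ.erase i, ‖((n : ℝ) + 1)⁻¹ • (x i - x j)‖ ≤ ((n : ℝ) + 1)⁻¹ * d := by
    intro j _
    rw [norm_smul, Real.norm_of_nonneg (by positivity), ← dist_eq_norm]
    exact mul_le_mul_of_nonneg_left (hx i j) (by positivity)
  -- The `i`-th term vanishes, which leaves `n` terms of norm at most `d / (n + 1)`; then `n / (n +
  -- 1) ≤ 1 - 1 / m`.
  rw [dist_eq_norm, h1, ← Finset.sum_erase (a := i) _ (by simp)]
  refine (norm_sum_le_of_le _ hterm).trans ?_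
  rw [Finset.sum_const, Finset.card_erase_of_mem (Finset.mem_univ i), Finset.card_univ,
    Fintype.card_fin, Nat.add_sub_cancel, nsmul_eq_mul, ← mul_assoc]
  refine mul_le_mul_of_nonneg_right ?_ hd
  have h2 : (m : ℝ)⁻¹ ≤ ((n : ℝ) + 1)⁻¹ :=
    inv_anti₀ (by positivity) (by exact_mod_cast hn)
  have h3 : (n : ℝ) * ((n : ℝ) + 1)⁻¹ = 1 - ((n : ℝ) + 1)⁻¹ := by field_simp; ring
  linarith

/-- Staying in the hull of `x` is part of the induction because it bounds the distance from the new
barycenter to the vertices coming from the faces. Keeping `m` fixed gives one contraction factor for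
all faces. -/
theorem sd_single_mem_mesh {d : ℝ} {m n : ℕ} (hn : n ≤ m) {x : Fin n → E}
    (hx : x ∈ meshLE E d n) :
    sd n (Finsupp.single x 1) ∈ Finsupp.supported ℝ ℝ
      (meshLE E ((1 - (m : ℝ)⁻¹) * d) n ∩ {y | ∀ i, y i ∈ convexHull ℝ (Set.range x)}) := by
  induction n with
  | zero =>
    refine Finsupp.single_mem_supported ℝ _ ⟨fun i => i.elim0, fun i => i.elim0⟩
  | succ n ih =>
    have hd : 0 ≤ (1 - (m : ℝ)⁻¹) * d := dist_nonneg.trans (dist_barycenter_le hn hx 0)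
    rw [sd_single, bdry_single, map_sum, map_sum]
    refine sum_mem fun i _ => ?_
    rw [map_smul, map_smul]
    refine Submodule.smul_mem _ _ (map_mem_of_supported (fun y hy => ?_)
      (ih (x := fun j => x (i.succAbove j)) (by omega) fun j k => hx _ _))
    rw [cone_single]
    have hy2 : ∀ j, y j ∈ convexHull ℝ (Set.range x) := fun j =>
      convexHull_mono (by rintro _ ⟨k, rfl⟩; exact ⟨_, rfl⟩) (hy.2 j)
    have hball : convexHull ℝ (Set.range x) ⊆
        Metric.closedBall (∑ j, ((n : ℝ) + 1)⁻¹ • x j) ((1 - (m : ℝ)⁻¹) * d) := by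
      refine convexHull_min ?_ (convex_closedBall _ _)
      rintro _ ⟨k, rfl⟩
      exact dist_barycenter_le hn hx k
    refine Finsupp.single_mem_supported ℝ _ ⟨fun j k => ?_, fun j => ?_⟩
    · refine Fin.cases ?_ (fun j => ?_) j <;> refine Fin.cases ?_ (fun k => ?_) k
      · simpa using hd
      · simpa [dist_comm] using hball (hy2 k)
      · simpa using hball (hy2 j)
      · simpa using hy.1 j k
    · refine Fin.cases ?_ (fun j => ?_) j
      · simpa using barycenter_mem (convex_convexHull ℝ _)
          fun k => subset_convexHull ℝ _ (Set.mem_range_self k)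
      · simpa using hy2 j

theorem sdIter_mem_mesh {d : ℝ} (r n : ℕ) {c : OChain E n}
    (hc : c ∈ Finsupp.supported ℝ ℝ (meshLE E d n)) :
    sdIter r n c ∈ Finsupp.supported ℝ ℝ (meshLE E ((1 - (n : ℝ)⁻¹) ^ r * d) n) := by
  induction r with
  | zero => simpa [sdIter] using hc
  | succ r ih =>
    rw [sdIter_succ]
    refine map_mem_of_supported (fun x hx => ?_) ih
    rw [pow_succ', mul_assoc]
    exact Finsupp.supported_mono Set.inter_subset_left (sd_single_mem_mesh le_rfl hx)

theorem exists_mem_mesh {E : Type*} [NormedAddCommGroup E] {n : ℕ} (c : OChain E n) :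
    ∃ d, c ∈ Finsupp.supported ℝ ℝ (meshLE E d n) := by
  obtain ⟨d, hd⟩ := (((c.support ×ˢ (Finset.univ ×ˢ Finset.univ)).image
    fun t : (Fin n → E) × Fin n × Fin n => dist (t.1 t.2.1) (t.1 t.2.2)).finite_toSet).bddAbove
  refine ⟨d, fun x hx i j => hd ?_⟩
  simp only [Finset.coe_image, Set.mem_image]
  exact ⟨(x, i, j), by simpa using hx, rfl⟩

/-- Sufficiently many barycentric subdivisions make the simplices of a chain arbitrarily small. -/
theorem exists_sdIter_mem_mesh {n : ℕ} (c : OChain E n) {δ : ℝ} (hδ : 0 < δ) :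
    ∃ r, sdIter r n c ∈ Finsupp.supported ℝ ℝ (meshLE E δ n) := by
  obtain ⟨d, hd⟩ := exists_mem_mesh c
  rcases n.eq_zero_or_pos with rfl | hn
  · exact ⟨0, fun x _ i => i.elim0⟩
  · have hn' : (0 : ℝ) < (n : ℝ)⁻¹ := by positivity
    have hn1 : (n : ℝ)⁻¹ ≤ 1 := inv_le_one_of_one_le₀ (by exact_mod_cast hn)
    have ht : Filter.Tendsto (fun r : ℕ => (1 - (n : ℝ)⁻¹) ^ r * d) Filter.atTop (nhds 0) := by
      simpa using (tendsto_pow_atTop_nhds_zero_of_lt_one (by linarith : (0 : ℝ) ≤ 1 - (n : ℝ)⁻¹)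
        (by linarith)).mul_const d
    obtain ⟨r, hr⟩ := (ht.eventually (gt_mem_nhds hδ)).exists
    refine ⟨r, Finsupp.supported_mono (fun x hx i j => (hx i j).trans hr.le)
      (sdIter_mem_mesh r n hd)⟩

end OChain

end Mesh

/-! ### Signs of tuples as determinants of incidence matrices -/

section TupleDet

variable {E : Type*} [DecidableEq E]

/-- The determinant of the incidence matrix of two tuples: the sign of the permutation relating
them if both are injective with the same range, and `0` otherwise. -/
def tupleDet {n : ℕ} (x y : Fin n → E) : ℝ :=
  (Matrix.of fun i j => if x i = y j then (1 : ℝ) else 0).det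

theorem tupleDet_self {n : ℕ} {x : Fin n → E} (hx : Function.Injective x) :
    tupleDet x x = 1 := by
  rw [tupleDet, ← Matrix.det_one (n := Fin n)]
  congr 1
  ext i j
  simp [Matrix.one_apply, hx.eq_iff]

theorem range_eq_of_tupleDet_ne_zero {n : ℕ} {x y : Fin n → E} (h : tupleDet x y ≠ 0) :
    Set.range x = Set.range y := by
  refine Set.Subset.antisymm ?_ ?_
  · rintro _ ⟨i, rfl⟩
    by_contra hi
    refine h (Matrix.det_eq_zero_of_row_eq_zero i fun j => ?_)
    simp only [Matrix.of_apply, ite_eq_right_iff]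
    exact fun hij => absurd ⟨j, hij.symm⟩ hi
  · rintro _ ⟨j, rfl⟩
    by_contra hj
    refine h (Matrix.det_eq_zero_of_column_eq_zero j fun i => ?_)
    simp only [Matrix.of_apply, ite_eq_right_iff]
    exact fun hij => absurd ⟨i, hij⟩ hj

theorem tupleDet_expand {n : ℕ} (x y : Fin (n + 1) → E) (j : Fin (n + 1)) :
    (-1 : ℝ) ^ (j : ℕ) * tupleDet x y = ∑ i : Fin (n + 1), (-1 : ℝ) ^ (i : ℕ) *
      ((if x i = y j then 1 else 0) *
        tupleDet (fun a => x (i.succAbove a)) fun b => y (j.succAbove b)) := by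
  rw [tupleDet, Matrix.det_succ_column _ j, Finset.mul_sum]
  refine Finset.sum_congr rfl fun i _ => ?_
  have h : (-1 : ℝ) ^ (j : ℕ) * (-1) ^ ((i : ℕ) + j) = (-1) ^ (i : ℕ) := by
    rw [pow_add, mul_comm, mul_assoc, ← mul_pow]
    simp
  rw [mul_assoc, ← mul_assoc, h]
  rfl

/-- This is the expansion along the first column of a determinant whose first column, the indicator
of the range of `y`, is the sum of the others because `y` is injective. -/
theorem sum_tupleDet_of_mem_range {n : ℕ} (x : Fin (n + 1) → E) {y : Fin n → E}
    (hy : Function.Injective y) :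
    ∑ i : Fin (n + 1), (-1 : ℝ) ^ (i : ℕ) *
      ((if ∃ b, y b = x i then 1 else 0) * tupleDet (fun a => x (i.succAbove a)) y) = 0 := by
  let B : Matrix (Fin (n + 1)) (Fin (n + 1)) ℝ := Matrix.of fun i =>
    Fin.cons (if ∃ b, y b = x i then 1 else 0) fun b => if x i = y b then 1 else 0
  have hB : B.det = 0 := by
    rw [← Matrix.exists_mulVec_eq_zero_iff]
    refine ⟨Fin.cons 1 fun _ => -1, fun h => ?_, ?_⟩
    · simpa using congrFun h 0
    · ext i
      simp only [Matrix.mulVec, dotProduct, Fin.sum_univ_succ, B, Matrix.of_apply, Fin.cons_zero,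
        Fin.cons_succ, mul_one, mul_neg, Finset.sum_neg_distrib, Pi.zero_apply]
      rw [← sub_eq_add_neg, sub_eq_zero]
      split_ifs with h
      · obtain ⟨b, hb⟩ := h
        rw [Finset.sum_eq_single b]
        · simp [hb]
        · intro b' _ hb'
          rw [if_neg]
          intro h'
          exact hb' (hy (h'.symm.trans hb.symm))
        · simp
      · refine (Finset.sum_eq_zero fun b _ => ?_).symm
        rw [if_neg]
        exact fun h' => h ⟨b, h'.symm⟩
  refine Eq.trans ?_ hB
  rw [Matrix.det_succ_column_zero]
  refine Finset.sum_congr rfl fun i _ => ?_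
  rw [mul_assoc]
  rfl

end TupleDet

/-! ### Comparison of oriented and ordered chains -/

section Orientation

variable {E : Type*} [AddCommGroup E] [Module ℝ E] [LinearOrder E]
  {K : Geometry.SimplicialComplex ℝ E}

theorem Simplex.vertex_mem {k : ℕ} (s : Simplex K k) (i : Fin (k + 1)) : s.vertex i ∈ s.1 :=
  s.1.orderEmbOfFin_mem s.2.2 i

theorem Simplex.vertex_injective {k : ℕ} (s : Simplex K k) : Function.Injective s.vertex :=
  (s.1.orderEmbOfFin s.2.2).injective

theorem Simplex.range_vertex {k : ℕ} (s : Simplex K k) : Set.range s.vertex = s.1 :=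
  s.1.range_orderEmbOfFin s.2.2

theorem Simplex.mem_iff {k : ℕ} (s : Simplex K k) {w : E} : w ∈ s.1 ↔ ∃ i, s.vertex i = w := by
  rw [← Finset.mem_coe, ← s.range_vertex, Set.mem_range]

theorem Simplex.ext_of_subset {E : Type*} [AddCommGroup E] [Module ℝ E]
    {K : Geometry.SimplicialComplex ℝ E} {k : ℕ} {s t : Simplex K k} (h : s.1 ⊆ t.1) : s = t :=
  Subtype.ext (Finset.eq_of_subset_of_card_le h (by rw [s.2.2, t.2.2]))

theorem Simplex.face_vertex {k : ℕ} (s : Simplex K (k + 1)) (i : Fin (k + 2)) (j : Fin (k + 1)) :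
    (s.face i).vertex j = s.vertex (i.succAbove j) := by
  have h := Finset.orderEmbOfFin_unique (s.face i).2.2
    (f := fun j => s.vertex (i.succAbove j))
    (fun j => Finset.mem_erase.2 ⟨fun h => Fin.succAbove_ne i j (s.vertex_injective h),
      s.vertex_mem _⟩)
    ((s.1.orderEmbOfFin s.2.2).strictMono.comp (Fin.strictMono_succAbove i))
  exact (congrFun h j).symm

theorem Simplex.face_val {k : ℕ} (s : Simplex K (k + 1)) (i : Fin (k + 2)) :
    (s.face i).1 = s.1.erase (s.vertex i) := rfl

/-- The join of a simplex with a new vertex, when it is a simplex of the complex. -/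
theorem Simplex.exists_coface {k : ℕ} (ρ : Simplex K k) {w : E} (hw : w ∉ ρ.1)
    (h : insert w ρ.1 ∈ K.faces) :
    ∃ (s : Simplex K (k + 1)) (j : Fin (k + 2)), s.1 = insert w ρ.1 ∧ s.face j = ρ ∧
      s.vertex j = w := by
  let s : Simplex K (k + 1) := ⟨insert w ρ.1, h, by rw [Finset.card_insert_of_notMem hw, ρ.2.2]⟩
  obtain ⟨j, hj⟩ := s.mem_iff.1 (Finset.mem_insert_self w ρ.1)
  refine ⟨s, j, rfl, Subtype.ext ?_, hj⟩
  rw [s.face_val, hj]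
  exact Finset.erase_insert hw

theorem Simplex.val_eq_insert {k : ℕ} {s : Simplex K (k + 1)} {j : Fin (k + 2)}
    {ρ : Simplex K k} (h : s.face j = ρ) : s.1 = insert (s.vertex j) ρ.1 := by
  rw [← h, s.face_val, Finset.insert_erase (s.vertex_mem j)]

theorem Simplex.vertex_notMem_face {k : ℕ} {s : Simplex K (k + 1)} {j : Fin (k + 2)}
    {ρ : Simplex K k} (h : s.face j = ρ) : s.vertex j ∉ ρ.1 := by
  rw [← h, s.face_val]
  exact Finset.notMem_erase _ _

theorem Simplex.eq_of_face_eq {k : ℕ} {s s' : Simplex K (k + 1)} {j j' : Fin (k + 2)}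
    {ρ : Simplex K k} (h : s.face j = ρ) (h' : s'.face j' = ρ) (hv : s.vertex j = s'.vertex j') :
    s = s' ∧ j = j' := by
  obtain rfl : s = s' :=
    Subtype.ext (by rw [s.val_eq_insert h, s'.val_eq_insert h', hv])
  exact ⟨rfl, s.vertex_injective hv⟩

theorem boundary_single {k : ℕ} (s : Simplex K (k + 1)) :
    boundary K k (Finsupp.single s 1) =
      ∑ i : Fin (k + 2), (-1 : ℝ) ^ (i : ℕ) • Finsupp.single (s.face i) (1 : ℝ) := by
  simp [boundary]

theorem boundary_apply {k : ℕ} [Fintype (Simplex K (k + 1))] (c : Chain K (k + 1))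
    (ρ : Simplex K k) : boundary K k c ρ =
      ∑ s, ∑ j : Fin (k + 2), if s.face j = ρ then (-1 : ℝ) ^ (j : ℕ) * c s else 0 := by
  rw [boundary, Finsupp.linearCombination_apply, Finsupp.sum_fintype _ _ (by simp),
    Finsupp.finsetSum_apply]
  refine Finset.sum_congr rfl fun s _ => ?_
  rw [Finsupp.smul_apply, Finsupp.finsetSum_apply, Finset.smul_sum]
  refine Finset.sum_congr rfl fun j _ => ?_
  rw [Finsupp.smul_apply, Finsupp.single_apply]
  split_ifs <;> simp [mul_comm]

variable (K) in
/-- The inclusion of oriented chains into ordered chains given by the increasing order of the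
vertices. -/
noncomputable def toOrdered (k : ℕ) : Chain K k →ₗ[ℝ] OChain E (k + 1) :=
  Finsupp.lmapDomain ℝ ℝ Simplex.vertex

theorem toOrdered_single {k : ℕ} (s : Simplex K k) (r : ℝ) :
    toOrdered K k (Finsupp.single s r) = Finsupp.single s.vertex r := by
  simp [toOrdered]

theorem bdry_toOrdered {k : ℕ} (c : Chain K (k + 1)) :
    OChain.bdry (k + 1) (toOrdered K (k + 1) c) = toOrdered K k (boundary K k c) := by
  suffices h : OChain.bdry (k + 1) ∘ₗ toOrdered K (k + 1) = toOrdered K k ∘ₗ boundary K k from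
    LinearMap.congr_fun h c
  refine Finsupp.lhom_ext' fun s => LinearMap.ext_ring ?_
  simp only [LinearMap.comp_apply, Finsupp.lsingle_apply, toOrdered_single, boundary_single,
    OChain.bdry_single, map_sum, map_smul]
  refine Finset.sum_congr rfl fun i _ => ?_
  congr 2
  exact funext fun j => (s.face_vertex i j).symm

theorem toOrdered_mem {k : ℕ} (c : Chain K k) : toOrdered K k c ∈
    Finsupp.supported ℝ ℝ {x : Fin (k + 1) → E | ∃ σ ∈ K.faces, ∀ i, x i ∈ σ} := by
  refine OChain.map_mem_of_supported (S := Set.univ) (fun s _ => ?_) (by simp)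
  rw [toOrdered_single]
  exact Finsupp.single_mem_supported ℝ _ ⟨s.1, s.2.1, s.vertex_mem⟩

variable [Finite K.faces]

variable (K) in
/-- The projection from ordered chains to oriented chains. -/
noncomputable def toOriented (k : ℕ) : OChain E (k + 1) →ₗ[ℝ] Chain K k :=
  Finsupp.linearCombination ℝ fun x => Finsupp.equivFunOnFinite.symm fun s : Simplex K k =>
    tupleDet x s.vertex

theorem toOriented_single {k : ℕ} (x : Fin (k + 1) → E) (s : Simplex K k) :
    toOriented K k (Finsupp.single x 1) s = tupleDet x s.vertex := by
  simp [toOriented]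

theorem toOriented_toOrdered {k : ℕ} (c : Chain K k) : toOriented K k (toOrdered K k c) = c := by
  suffices h : toOriented K k ∘ₗ toOrdered K k = LinearMap.id from LinearMap.congr_fun h c
  refine Finsupp.lhom_ext' fun s => LinearMap.ext_ring (Finsupp.ext fun t => ?_)
  simp only [LinearMap.comp_apply, Finsupp.lsingle_apply, toOrdered_single, toOriented_single,
    LinearMap.id_apply, Finsupp.single_apply]
  split_ifs with h
  · rw [h, tupleDet_self t.vertex_injective]
  · by_contra h'
    have := range_eq_of_tupleDet_ne_zero h'
    rw [s.range_vertex, t.range_vertex, Finset.coe_inj] at this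
    exact h (Subtype.ext this)

theorem toOrdered_toOriented_mem {A : Set E} {k : ℕ} {c : OChain E (k + 1)}
    (hc : c ∈ OChain.inSet A (k + 1)) :
    toOrdered K k (toOriented K k c) ∈ OChain.inSet A (k + 1) := by
  suffices h : (toOrdered K k ∘ₗ toOriented K k) c ∈ OChain.inSet A (k + 1) from h
  refine OChain.map_mem_of_supported (fun x hx => ?_) hc
  rw [LinearMap.comp_apply]
  refine OChain.map_mem_of_supported (S := {s : Simplex K k | Set.range s.vertex = Set.range x})
    (fun s hs => ?_) fun s hs => ?_
  · rw [toOrdered_single]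
    refine OChain.single_mem_inSet (fun i => ?_) 1
    obtain ⟨j, hj⟩ := (Set.ext_iff.1 hs (s.vertex i)).1 ⟨i, rfl⟩
    exact hj ▸ hx j
  · have hs : toOriented K k (Finsupp.single x 1) s ≠ 0 := Finsupp.mem_support_iff.1 hs
    rw [toOriented_single] at hs
    exact (range_eq_of_tupleDet_ne_zero hs).symm

/-- At `ρ`, each determinant is expanded along the column of the vertex missing from `ρ`. If the
entries of `x` other than `x i` enumerate `ρ`, then exactly one coface adds `x i` when `x i ∉ ρ`
(the join is a simplex since all entries lie in `σ`), and none does when `x i ∈ ρ`. The degenerate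
indices of the second kind contribute zero in total by `sum_tupleDet_of_mem_range`. -/
theorem boundary_toOriented_single {k : ℕ} {x : Fin (k + 2) → E}
    (hx : ∃ σ ∈ K.faces, ∀ i, x i ∈ σ) :
    boundary K k (toOriented K (k + 1) (Finsupp.single x 1)) =
      toOriented K k (OChain.bdry (k + 1) (Finsupp.single x 1)) := by
  classical
  obtain ⟨σ, hσ, hxσ⟩ := hx
  have := Fintype.ofFinite (Simplex K (k + 1))
  ext ρ
  rw [boundary_apply, OChain.bdry_single, map_sum, Finsupp.finsetSum_apply]
  simp only [map_smul, Finsupp.smul_apply, toOriented_single, smul_eq_mul]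
  let d : Fin (k + 2) → ℝ := fun i => tupleDet (fun a => x (i.succAbove a)) ρ.vertex
  have hterm : ∀ (s : Simplex K (k + 1)) (j : Fin (k + 2)),
      (if s.face j = ρ then (-1 : ℝ) ^ (j : ℕ) * tupleDet x s.vertex else 0) =
        ∑ i : Fin (k + 2), (-1 : ℝ) ^ (i : ℕ) * d i *
          (if s.face j = ρ ∧ x i = s.vertex j then 1 else 0) := by
    intro s j
    split_ifs with h
    · rw [tupleDet_expand]
      refine Finset.sum_congr rfl fun i _ => ?_
      have : (fun b => s.vertex (j.succAbove b)) = ρ.vertex := by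
        rw [← h]
        exact funext fun b => (s.face_vertex j b).symm
      rw [this]
      simp only [h, true_and, d]
      ring
    · simp [h]
  simp only [hterm]
  have hcount : ∀ i, d i * ∑ s : Simplex K (k + 1), ∑ j : Fin (k + 2),
      (if s.face j = ρ ∧ x i = s.vertex j then (1 : ℝ) else 0) =
        d i - (if ∃ b, ρ.vertex b = x i then 1 else 0) * d i := by
    intro i
    by_cases hd : d i = 0
    · simp [hd]
    have hr := range_eq_of_tupleDet_ne_zero hd
    rw [ρ.range_vertex] at hr
    by_cases hi : x i ∈ ρ.1
    · rw [if_pos (ρ.mem_iff.1 hi), one_mul, sub_self, Finset.sum_eq_zero, mul_zero]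
      intro s _
      refine Finset.sum_eq_zero fun j _ => if_neg ?_
      rintro ⟨h1, h2⟩
      exact s.vertex_notMem_face h1 (h2 ▸ hi)
    · have hface : insert (x i) ρ.1 ∈ K.faces := by
        refine K.down_closed hσ (Finset.insert_subset (hxσ i) fun w hw => ?_)
          (Finset.insert_nonempty _ _)
        rw [← Finset.mem_coe, ← hr] at hw
        obtain ⟨a, rfl⟩ := hw
        exact hxσ _
      obtain ⟨s, j, -, h1, h2⟩ := ρ.exists_coface hi hface
      rw [if_neg (fun h => hi (ρ.mem_iff.2 h)), zero_mul, sub_zero, Finset.sum_eq_single s,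
        Finset.sum_eq_single j, if_pos ⟨h1, h2.symm⟩, mul_one]
      · rintro j' - hj'
        refine if_neg ?_
        rintro ⟨h1', h2'⟩
        exact hj' (s.vertex_injective (h2'.symm.trans h2.symm))
      · simp
      · rintro s' - hs'
        refine Finset.sum_eq_zero fun j' _ => if_neg ?_
        rintro ⟨h1', h2'⟩
        exact hs' (Simplex.eq_of_face_eq h1' h1 (h2'.symm.trans h2.symm)).1
      · simp
  calc _ = ∑ i : Fin (k + 2), (-1 : ℝ) ^ (i : ℕ) * (d i * ∑ s : Simplex K (k + 1),
      ∑ j : Fin (k + 2), (if s.face j = ρ ∧ x i = s.vertex j then (1 : ℝ) else 0)) := by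
        rw [Finset.sum_congr rfl fun s _ => Finset.sum_comm, Finset.sum_comm]
        refine Finset.sum_congr rfl fun i _ => ?_
        simp only [Finset.mul_sum, mul_assoc]
    _ = ∑ i : Fin (k + 2), (-1 : ℝ) ^ (i : ℕ) * d i - ∑ i : Fin (k + 2), (-1 : ℝ) ^ (i : ℕ) *
        ((if ∃ b, ρ.vertex b = x i then 1 else 0) * d i) := by
        rw [← Finset.sum_sub_distrib]
        refine Finset.sum_congr rfl fun i _ => ?_
        rw [hcount, mul_sub]
    _ = _ := by
        rw [sum_tupleDet_of_mem_range x ρ.vertex_injective, sub_zero]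

theorem boundary_toOriented {k : ℕ} {c : OChain E (k + 2)}
    (hc : c ∈ Finsupp.supported ℝ ℝ {x : Fin (k + 2) → E | ∃ σ ∈ K.faces, ∀ i, x i ∈ σ}) :
    boundary K k (toOriented K (k + 1) c) = toOriented K k (OChain.bdry (k + 1) c) := by
  suffices h : (boundary K k ∘ₗ toOriented K (k + 1)) c = (toOriented K k ∘ₗ OChain.bdry (k + 1)) c
    from h
  exact OChain.map_eq_of_supported (fun x hx => boundary_toOriented_single hx) hc

theorem boundary_boundary {k : ℕ} (c : Chain K (k + 2)) :
    boundary K k (boundary K (k + 1) c) = 0 := by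
  rw [← toOriented_toOrdered (boundary K k _), ← bdry_toOrdered, ← bdry_toOrdered,
    OChain.bdry_bdry, map_zero]

end Orientation

/-! ### Carriers of points and vertex maps -/

section Carrier

variable {E : Type*} [AddCommGroup E] [Module ℝ E]

/-- Barycentric coordinates with respect to the vertices of a simplex, extended to affine functions
on the whole space. -/
theorem exists_barycentric_coords {σ : Finset E}
    (hσ : AffineIndependent ℝ ((↑) : σ → E)) :
    ∃ l : E → E →ᵃ[ℝ] ℝ, (∀ y ∈ σ, l y y = 1) ∧ ∀ y ∈ σ, ∀ z ∈ σ, y ≠ z → l y z = 0 := by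
  classical
  rcases σ.eq_empty_or_nonempty with rfl | hne
  · exact ⟨fun _ => AffineMap.const ℝ E 0, by simp, by simp⟩
  obtain ⟨t, hst, ht, htop⟩ := exists_subset_affineIndependent_affineSpan_eq_top
    (s := (σ : Set E)) hσ
  let b : AffineBasis t ℝ E := ⟨((↑) : t → E), ht, by simpa using htop⟩
  refine ⟨fun y => if hy : y ∈ t then b.coord ⟨y, hy⟩ else AffineMap.const ℝ E 0,
    fun y hy => ?_, fun y hy z hz hyz => ?_⟩
  · simp only [dif_pos (show y ∈ t from hst hy)]
    exact b.coord_apply_eq ⟨y, hst hy⟩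
  · simp only [dif_pos (show y ∈ t from hst hy)]
    exact b.coord_apply_ne (i := ⟨y, hst hy⟩) (j := ⟨z, hst hz⟩)
      (fun h => hyz (congrArg Subtype.val h))

theorem map_sum_of_sum_eq_one {F : Type*} [AddCommGroup F] [Module ℝ F] (l : E →ᵃ[ℝ] F)
    {ι : Type*} (s : Finset ι) (w : ι → ℝ) (z : ι → E) (hw : ∑ i ∈ s, w i = 1) :
    l (∑ i ∈ s, w i • z i) = ∑ i ∈ s, w i • l (z i) := by
  have h1 := s.map_affineCombination z w hw l
  rw [s.affineCombination_eq_linear_combination _ _ hw,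
    s.affineCombination_eq_linear_combination _ _ hw] at h1
  simpa using h1

variable {K : Geometry.SimplicialComplex ℝ E}

/-- Every point of a simplicial complex lies in a smallest simplex, and in its relative interior. -/
theorem exists_carrier {x : E} (hx : x ∈ K.space) :
    ∃ τ ∈ K.faces, (∀ σ ∈ K.faces, x ∈ convexHull ℝ (σ : Set E) → τ ⊆ σ) ∧
      ∃ w : E → ℝ, (∀ y ∈ τ, 0 < w y) ∧ ∑ y ∈ τ, w y = 1 ∧ ∑ y ∈ τ, w y • y = x := by
  classical
  have hex : ∃ n, ∃ τ ∈ K.faces, x ∈ convexHull ℝ (τ : Set E) ∧ τ.card = n := by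
    obtain ⟨τ, hτ, hxτ⟩ := Geometry.SimplicialComplex.mem_space_iff.1 hx
    exact ⟨_, τ, hτ, hxτ, rfl⟩
  obtain ⟨τ, hτ, hxτ, hn⟩ := Nat.find_spec hex
  have hmin : ∀ σ ∈ K.faces, x ∈ convexHull ℝ (σ : Set E) → τ.card ≤ σ.card := fun σ hσ hxσ => by
    rw [hn]
    exact Nat.find_min' hex ⟨σ, hσ, hxσ, rfl⟩
  have hsub : ∀ ρ ⊆ τ, x ∈ convexHull ℝ (ρ : Set E) → ρ = τ := fun ρ hρ hxρ => by
    have hne : ρ.Nonempty := by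
      rw [← Finset.coe_nonempty, ← convexHull_nonempty_iff (𝕜 := ℝ)]
      exact ⟨x, hxρ⟩
    exact Finset.eq_of_subset_of_card_le hρ (hmin ρ (K.down_closed hτ hρ hne) hxρ)
  refine ⟨τ, hτ, fun σ hσ hxσ => ?_, ?_⟩
  · have h := hsub (τ ∩ σ) Finset.inter_subset_left (by
      rw [Finset.coe_inter]
      exact K.inter_subset_convexHull hτ hσ ⟨hxτ, hxσ⟩)
    exact Finset.inter_eq_left.1 h
  · obtain ⟨w, hw0, hw1, hwx⟩ := Finset.mem_convexHull'.1 hxτ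
    refine ⟨w, fun y hy => lt_of_le_of_ne (hw0 y hy) fun h0 => ?_, hw1, hwx⟩
    have h := hsub (τ.erase y) (Finset.erase_subset _ _) (by
      refine Finset.mem_convexHull'.2 ⟨w, fun z hz => hw0 z (Finset.mem_of_mem_erase hz), ?_, ?_⟩
      · rw [Finset.sum_erase _ h0.symm, hw1]
      · rw [Finset.sum_erase _ (by rw [← h0, zero_smul]), hwx])
    exact Finset.notMem_erase y τ (by rw [h]; exact hy)

/-- A vertex map: a choice of a vertex of the carrier of each point. -/
theorem exists_vertex_map (K : Geometry.SimplicialComplex ℝ E) : ∃ v : E → E, ∀ x ∈ K.space,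
    ∀ σ ∈ K.faces, x ∈ convexHull ℝ (σ : Set E) → v x ∈ σ := by
  have : ∀ x, ∃ y, x ∈ K.space → ∀ σ ∈ K.faces, x ∈ convexHull ℝ (σ : Set E) → y ∈ σ := by
    intro x
    by_cases hx : x ∈ K.space
    · obtain ⟨τ, hτ, hmin, -⟩ := exists_carrier hx
      obtain ⟨y, hy⟩ := K.nonempty_of_mem_faces hτ
      exact ⟨y, fun _ σ hσ hxσ => hmin σ hσ hxσ hy⟩
    · exact ⟨x, fun h => absurd h hx⟩
  choose v hv using this
  exact ⟨v, fun x hx => hv x hx⟩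

theorem mem_convexHull_of_coords_eq_zero {σ ρ : Finset E} (hρ : ρ ⊆ σ) {l : E → E →ᵃ[ℝ] ℝ}
    (h1 : ∀ y ∈ σ, l y y = 1) (h0 : ∀ y ∈ σ, ∀ z ∈ σ, y ≠ z → l y z = 0) {x : E}
    (hx : x ∈ convexHull ℝ (σ : Set E)) (hz : ∀ y ∈ σ, y ∉ ρ → l y x = 0) :
    x ∈ convexHull ℝ (ρ : Set E) := by
  obtain ⟨w, hw0, hw1, rfl⟩ := Finset.mem_convexHull'.1 hx
  have hw : ∀ y ∈ σ, y ∉ ρ → w y = 0 := by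
    intro y hy hyρ
    have := hz y hy hyρ
    rw [map_sum_of_sum_eq_one _ _ _ _ hw1, Finset.sum_eq_single y] at this
    · simpa [h1 y hy] using this
    · intro z hz hzy
      rw [h0 y hy z hz hzy.symm, smul_zero]
    · exact fun h => absurd hy h
  refine Finset.mem_convexHull'.2 ⟨w, fun y hy => hw0 y (hρ hy), ?_, ?_⟩
  · rw [← hw1]
    exact Finset.sum_subset hρ fun y hy hyρ => hw y hy hyρ
  · exact Finset.sum_subset hρ fun y hy hyρ => by rw [hw y hy hyρ, zero_smul]

theorem coords_nonneg {σ : Finset E} {l : E → E →ᵃ[ℝ] ℝ}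
    (h1 : ∀ y ∈ σ, l y y = 1) (h0 : ∀ y ∈ σ, ∀ z ∈ σ, y ≠ z → l y z = 0) {x : E}
    (hx : x ∈ convexHull ℝ (σ : Set E)) {y : E} (hy : y ∈ σ) : 0 ≤ l y x := by
  obtain ⟨w, hw0, hw1, rfl⟩ := Finset.mem_convexHull'.1 hx
  rw [map_sum_of_sum_eq_one _ _ _ _ hw1]
  refine Finset.sum_nonneg fun z hz => mul_nonneg (hw0 z hz) ?_
  by_cases h : y = z
  · rw [h, h1 z hz]; exact zero_le_one
  · rw [h0 y hy z hz h]

theorem coords_eq_zero {σ ρ : Finset E} (hρ : ρ ⊆ σ) {l : E → E →ᵃ[ℝ] ℝ}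
    (h0 : ∀ y ∈ σ, ∀ z ∈ σ, y ≠ z → l y z = 0) {x : E}
    (hx : x ∈ convexHull ℝ (ρ : Set E)) {y : E} (hy : y ∈ σ) (hyρ : y ∉ ρ) : l y x = 0 := by
  obtain ⟨w, hw0, hw1, rfl⟩ := Finset.mem_convexHull'.1 hx
  rw [map_sum_of_sum_eq_one _ _ _ _ hw1]
  refine Finset.sum_eq_zero fun z hz => ?_
  rw [h0 y hy z (hρ hz) (fun h => hyρ (h ▸ hz)), smul_zero]

variable {N M : Geometry.SimplicialComplex ℝ E}

/-- If a simplex of the coarse complex meets the relative interior of a simplex of the subdivision,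
then it contains that simplex. -/
theorem IsSubdivision.subset_convexHull (hNM : IsSubdivision N M) {σ τ : Finset E}
    (hσ : σ ∈ N.faces) (hτ : τ ∈ M.faces) {x : E} {w : E → ℝ} (hw : ∀ y ∈ τ, 0 < w y)
    (hw1 : ∑ y ∈ τ, w y = 1) (hwx : ∑ y ∈ τ, w y • y = x) (hx : x ∈ convexHull ℝ (σ : Set E)) :
    (τ : Set E) ⊆ convexHull ℝ (σ : Set E) := by
  classical
  obtain ⟨σ', hσ', hτσ'⟩ := hNM.refines τ hτ
  obtain ⟨l, h1, h0⟩ := exists_barycentric_coords (N.indep hσ')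
  have hτσ : ∀ y ∈ τ, y ∈ convexHull ℝ (σ' : Set E) := fun y hy =>
    hτσ' (_root_.subset_convexHull ℝ _ hy)
  have hx' : x ∈ convexHull ℝ (σ' : Set E) := by
    rw [← hwx]
    exact (convex_convexHull ℝ _).sum_mem (fun y hy => (hw y hy).le) hw1 hτσ
  have hxi : x ∈ convexHull ℝ ((σ' ∩ σ : Finset E) : Set E) := by
    rw [Finset.coe_inter]
    exact N.inter_subset_convexHull hσ' hσ ⟨hx', hx⟩
  intro y hy
  have hmem : y ∈ convexHull ℝ ((σ' ∩ σ : Finset E) : Set E) := by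
    refine mem_convexHull_of_coords_eq_zero Finset.inter_subset_left h1 h0 (hτσ y hy)
      fun z hz hzρ => ?_
    have hzx := coords_eq_zero Finset.inter_subset_left h0 hxi hz hzρ
    simp only [← hwx, map_sum_of_sum_eq_one _ _ _ _ hw1, smul_eq_mul] at hzx
    -- A sum of nonnegative coordinates with strictly positive weights vanishes, so the coordinate
    -- vanishes at every vertex of `τ`.
    rw [Finset.sum_eq_zero_iff_of_nonneg fun y' hy' =>
      mul_nonneg (hw y' hy').le (coords_nonneg h1 h0 (hτσ y' hy') hz)] at hzx
    have := hzx y hy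
    rw [mul_eq_zero] at this
    exact this.resolve_left (hw y hy).ne'
  exact convexHull_mono (by simp) hmem

end Carrier

/-! ### Lebesgue numbers and simplicial approximation -/

section Lebesgue

/-- The set `c w` is the open star of `w`, with complement a finite union of compact simplices. The
number `δ` is a Lebesgue number of the cover by open stars, and `v x` is a vertex whose star
contains the `δ`-ball around `x`. -/
theorem exists_lebesgue_vertex_map {E : Type*} [NormedAddCommGroup E] [NormedSpace ℝ E]
    (K : Geometry.SimplicialComplex ℝ E) [Finite K.faces] :
    ∃ δ > 0, ∃ v : E → E, ∀ x ∈ K.space, ∀ y, dist y x < δ → ∀ σ ∈ K.faces,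
      y ∈ convexHull ℝ (σ : Set E) → v x ∈ σ := by
  classical
  have hfin : K.faces.Finite := Set.toFinite _
  have hcpt : ∀ σ : Finset E, IsCompact (convexHull ℝ (σ : Set E)) := fun σ =>
    σ.finite_toSet.isCompact_convexHull (𝕜 := ℝ)
  have hspace : IsCompact K.space := hfin.isCompact_biUnion fun σ _ => hcpt σ
  let c : E → Set E := fun w => {y | ∀ σ ∈ K.faces, y ∈ convexHull ℝ (σ : Set E) → w ∈ σ}
  have hc : ∀ w, IsOpen (c w) := by
    intro w
    have : c w = (⋃ σ ∈ {σ ∈ K.faces | w ∉ σ}, convexHull ℝ (σ : Set E))ᶜ := by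
      ext y
      simp only [c, Set.mem_ofPred_eq, Set.mem_compl_iff, Set.mem_iUnion, not_exists]
      exact ⟨fun h σ hσ hy => hσ.2 (h σ hσ.1 hy), fun h σ hσ hy => by
        by_contra hw
        exact h σ ⟨hσ, hw⟩ hy⟩
    rw [this]
    exact ((hfin.subset (Set.sep_subset _ _)).isCompact_biUnion fun σ _ =>
      hcpt σ).isClosed.isOpen_compl
  obtain ⟨v₀, hv₀⟩ := exists_vertex_map K
  obtain ⟨δ, hδ, hball⟩ := lebesgue_number_lemma_of_metric hspace hc
    (fun x hx => Set.mem_iUnion.2 ⟨v₀ x, hv₀ x hx⟩)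
  have : ∀ x, ∃ w, x ∈ K.space → Metric.ball x δ ⊆ c w := by
    intro x
    by_cases hx : x ∈ K.space
    · obtain ⟨w, hw⟩ := hball x hx
      exact ⟨w, fun _ => hw⟩
    · exact ⟨x, fun h => absurd h hx⟩
  choose v hv using this
  exact ⟨δ, hδ, v, fun x hx y hy => hv x hx hy⟩

theorem exists_normed_subdivision_approximation {E : Type*} [NormedAddCommGroup E]
    [NormedSpace ℝ E] (K : Geometry.SimplicialComplex ℝ E) [Finite K.faces] {n : ℕ}
    (c : OChain E (n + 1))
    (hc : c ∈ Finsupp.supported ℝ ℝ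
      {x : Fin (n + 1) → E | ∃ A, Convex ℝ A ∧ A ⊆ K.space ∧ ∀ i, x i ∈ A}) :
    ∃ (r : ℕ) (v : E → E), (∀ x ∈ K.space, ∀ σ ∈ K.faces, x ∈ convexHull ℝ (σ : Set E) → v x ∈ σ) ∧
      OChain.push v (n + 1) (OChain.sdIter r (n + 1) c) ∈
        Finsupp.supported ℝ ℝ {x : Fin (n + 1) → E | ∃ σ ∈ K.faces, ∀ i, x i ∈ σ} := by
  obtain ⟨δ, hδ, v, hv⟩ := exists_lebesgue_vertex_map K
  obtain ⟨r, hr⟩ := OChain.exists_sdIter_mem_mesh c (half_pos hδ)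
  refine ⟨r, v, fun x hx => hv x hx x (by simpa using hδ), ?_⟩
  have hspace : OChain.sdIter r (n + 1) c ∈ OChain.inSet K.space (n + 1) := by
    refine OChain.map_mem_of_supported (fun x hx => ?_) hc
    obtain ⟨A, hA, hAK, hxA⟩ := hx
    exact OChain.inSet_mono hAK _
      (OChain.sdIter_mem_inSet hA r _ (OChain.single_mem_inSet hxA 1))
  have hboth : OChain.sdIter r (n + 1) c ∈ Finsupp.supported ℝ ℝ
      (OChain.meshLE E (δ / 2) (n + 1) ∩ {x | ∀ i, x i ∈ K.space}) := fun x hx =>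
    ⟨hr hx, hspace hx⟩
  refine OChain.map_mem_of_supported (fun x hx => ?_) hboth
  rw [OChain.push_single]
  -- Any simplex containing the first vertex `x 0` will do: `x 0` is within `δ` of every `x i`, so
  -- it lies in the star of `v (x i)`.
  obtain ⟨σ, hσ, hxσ⟩ := Geometry.SimplicialComplex.mem_space_iff.1 (hx.2 0)
  exact Finsupp.single_mem_supported ℝ _ ⟨σ, hσ, fun i =>
    hv (x i) (hx.2 i) (x 0) ((hx.1 0 i).trans_lt (by linarith)) σ hσ hxσ⟩

/-- `E` is a bare vector space. An injection into a Hilbert space induces a norm, as the mesh and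
Lebesgue estimates require; any norm serves, since the resulting approximation statement mentions
none. -/
theorem exists_injective_linearMap_lp (E : Type*) [AddCommGroup E] [Module ℝ E] :
    ∃ f : E →ₗ[ℝ] lp (fun _ : Module.Basis.ofVectorSpaceIndex ℝ E => ℝ) 2,
      Function.Injective f := by
  let b := Module.Basis.ofVectorSpace ℝ E
  let e : HilbertBasis (Module.Basis.ofVectorSpaceIndex ℝ E) ℝ
    (lp (fun _ : Module.Basis.ofVectorSpaceIndex ℝ E => ℝ) 2) :=
    HilbertBasis.ofRepr (LinearIsometryEquiv.refl ℝ _)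
  have he : LinearIndependent ℝ e := e.orthonormal.linearIndependent
  refine ⟨Finsupp.linearCombination ℝ (fun i => e i) ∘ₗ b.repr.toLinearMap, ?_⟩
  rw [LinearMap.coe_comp]
  exact Function.Injective.comp he b.repr.injective

/-- An ordered chain in convex subsets of a finite simplicial complex becomes simplicial after
sufficiently many barycentric subdivisions, by a vertex map preserving carriers. -/
theorem exists_subdivision_approximation {E : Type*} [AddCommGroup E]
    [Module ℝ E] (K : Geometry.SimplicialComplex ℝ E) [Finite K.faces] {n : ℕ}
    (c : OChain E (n + 1))
    (hc : c ∈ Finsupp.supported ℝ ℝ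
      {x : Fin (n + 1) → E | ∃ A, Convex ℝ A ∧ A ⊆ K.space ∧ ∀ i, x i ∈ A}) :
    ∃ (r : ℕ) (v : E → E), (∀ x ∈ K.space, ∀ σ ∈ K.faces, x ∈ convexHull ℝ (σ : Set E) → v x ∈ σ) ∧
      OChain.push v (n + 1) (OChain.sdIter r (n + 1) c) ∈
        Finsupp.supported ℝ ℝ {x : Fin (n + 1) → E | ∃ σ ∈ K.faces, ∀ i, x i ∈ σ} := by
  obtain ⟨f, hf⟩ := exists_injective_linearMap_lp E
  let : NormedAddCommGroup E := NormedAddCommGroup.induced E _ f hf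
  let : NormedSpace ℝ E := NormedSpace.induced ℝ E _ f
  exact exists_normed_subdivision_approximation K c hc

end Lebesgue

/-! ### Simplicial approximation inverts the induced map; acyclicity of the cokernel -/

section Approximation

variable {E : Type*} [AddCommGroup E] [Module ℝ E] [LinearOrder E]
  {N M : Geometry.SimplicialComplex ℝ E}

theorem OChain.push_deg_zero {F : Type*} (v : F → F) : OChain.push v 0 = LinearMap.id := by
  refine OChain.eq_of_single fun x => ?_
  rw [OChain.push_single, LinearMap.id_apply]
  congr 1
  exact Subsingleton.elim _ _

theorem OChain.bdry_homotopy_of_supported {E : Type*} {F G : ∀ n, OChain E n →ₗ[ℝ] OChain E n}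
    {S : Set (Finset E)} (h0 : F 0 = G 0)
    (hF : ∀ τ ∈ S, ∀ n, ∀ c ∈ OChain.inSet (τ : Set E) (n + 1),
      OChain.bdry n (F (n + 1) c) = F n (OChain.bdry n c))
    (hG : ∀ τ ∈ S, ∀ n, ∀ c ∈ OChain.inSet (τ : Set E) (n + 1),
      OChain.bdry n (G (n + 1) c) = G n (OChain.bdry n c)) {n : ℕ} {c : OChain E (n + 1)}
    (hc : c ∈ Finsupp.supported ℝ ℝ {x : Fin (n + 1) → E | ∃ τ ∈ S, ∀ i, x i ∈ τ}) :
    OChain.bdry (n + 1) (OChain.homotopy F G (n + 1) c) =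
      F (n + 1) c - G (n + 1) c - OChain.homotopy F G n (OChain.bdry n c) := by
  suffices h : (OChain.bdry (n + 1) ∘ₗ OChain.homotopy F G (n + 1)) c =
      (F (n + 1) - G (n + 1) - OChain.homotopy F G n ∘ₗ OChain.bdry n :
        OChain E (n + 1) →ₗ[ℝ] OChain E (n + 1)) c from h
  refine OChain.map_eq_of_supported (fun x hx => ?_) hc
  obtain ⟨τ, hτ, hxτ⟩ := hx
  exact OChain.bdry_homotopy (A := (τ : Set E)) h0 (hF τ hτ) (hG τ hτ) n
    (OChain.single_mem_inSet hxτ 1)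

theorem IsSubdivision.vertex_map_mem {E : Type*} [AddCommGroup E] [Module ℝ E]
    {N M : Geometry.SimplicialComplex ℝ E} (hNM : IsSubdivision N M) {a : E → E}
    (ha : ∀ x ∈ N.space, ∀ σ ∈ N.faces, x ∈ convexHull ℝ (σ : Set E) → a x ∈ σ)
    {τ : Finset E} (hτ : τ ∈ M.faces) : ∃ σ ∈ N.faces,
      (τ : Set E) ⊆ convexHull ℝ (σ : Set E) ∧ ∀ x ∈ τ, a x ∈ σ := by
  obtain ⟨σ, hσ, hτσ⟩ := hNM.refines τ hτ
  have h : (τ : Set E) ⊆ convexHull ℝ (σ : Set E) := (_root_.subset_convexHull ℝ _).trans hτσ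
  exact ⟨σ, hσ, h, fun x hx => ha x (N.convexHull_subset_space hσ (h hx)) σ hσ (h hx)⟩

theorem orientationSign_eq_zero {k : ℕ} {σ : Simplex N k} {τ : Simplex M k}
    (h : ¬ (τ.1 : Set E) ⊆ convexHull ℝ (σ.1 : Set E)) : orientationSign σ τ = 0 := by
  have hB : ∀ B, ¬ IsBarycentricMatrix σ.vertex τ.vertex B := by
    rintro B ⟨h0, h1, hw⟩
    refine h fun x hx => ?_
    obtain ⟨i, rfl⟩ := τ.mem_iff.1 hx
    rw [hw i]
    exact (convex_convexHull ℝ _).sum_mem (fun j _ => h0 i j) (h1 i)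
      fun j _ => subset_convexHull ℝ _ (σ.vertex_mem j)
  rw [orientationSign, if_neg fun ⟨B, h, _⟩ => hB B h, if_neg fun ⟨B, h, _⟩ => hB B h]

theorem inclusion_single_apply [Finite M.faces] {k : ℕ} (σ : Simplex N k) (τ : Simplex M k) :
    inclusion N M k (Finsupp.single σ 1) τ = orientationSign σ τ := by
  simp [inclusion]

/-- A vertex `v` of `N` is a vertex of `M`, since its carrier in `M` is contained in the hull of
`{v}`. -/
theorem inclusion_single_zero [Finite M.faces] (hNM : IsSubdivision N M) (σ : Simplex N 0) :
    ∃ τ : Simplex M 0, τ.1 = σ.1 ∧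
      inclusion N M 0 (Finsupp.single σ 1) = Finsupp.single τ 1 := by
  obtain ⟨v, hv⟩ := Finset.card_eq_one.1 σ.2.2
  have hvσ : v ∈ convexHull ℝ (σ.1 : Set E) := by simp [hv]
  have hvM : v ∈ M.space := hNM.space_eq ▸ N.convexHull_subset_space σ.2.1 hvσ
  obtain ⟨τ, hτ, -, w, hw, hw1, hwv⟩ := exists_carrier hvM
  have hτσ := hNM.subset_convexHull σ.2.1 hτ hw hw1 hwv hvσ
  rw [hv, Finset.coe_singleton, convexHull_singleton] at hτσ
  have hτv : τ = {v} := Finset.eq_singleton_iff_nonempty_unique_mem.2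
    ⟨M.nonempty_of_mem_faces hτ, fun y hy => hτσ hy⟩
  let t : Simplex M 0 := ⟨τ, hτ, by simp [hτv]⟩
  have htσ : t.1 = σ.1 := by rw [hv, ← hτv]
  refine ⟨t, htσ, Finsupp.ext fun ρ => ?_⟩
  rw [inclusion_single_apply, Finsupp.single_apply]
  split_ifs with h
  · subst h
    rw [orientationSign, if_pos]
    refine ⟨1, ⟨fun i j => ?_, fun i => ?_, fun i => ?_⟩, by simp⟩
    · rw [Subsingleton.elim (α := Fin 1) i j]
      simp
    · rw [Fin.sum_univ_one, Subsingleton.elim (α := Fin 1) i 0]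
      simp
    · have hi : i = 0 := Subsingleton.elim (α := Fin 1) i 0
      have h1 := t.vertex_mem i
      have h2 := σ.vertex_mem i
      rw [htσ, hv, Finset.mem_singleton] at h1
      rw [hv, Finset.mem_singleton] at h2
      rw [h1, Fin.sum_univ_one, ← h2, hi]
      simp
  · refine orientationSign_eq_zero fun hsub => h ?_
    refine (Simplex.ext_of_subset (s := ρ) (t := t) ?_).symm
    rw [hv, Finset.coe_singleton, convexHull_singleton] at hsub
    rw [htσ, hv]
    exact fun y hy => Finset.mem_singleton.2 (hsub hy)

/-- The normalisation that recovers `r` from the boundary of `r • σ`. -/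
theorem boundary_single_face_zero {k : ℕ} (σ : Simplex N (k + 1)) :
    boundary N k (Finsupp.single σ 1) (σ.face 0) = 1 := by
  rw [boundary_single, Finsupp.finsetSum_apply, Finset.sum_eq_single 0]
  · simp
  · intro j _ hj
    rw [Finsupp.smul_apply, Finsupp.single_apply, if_neg, smul_zero]
    intro h
    have hmem : σ.vertex j ∈ (σ.face 0).1 :=
      Finset.mem_erase.2 ⟨fun h => hj (σ.vertex_injective h), σ.vertex_mem j⟩
    exact σ.vertex_notMem_face h hmem
  · simp

variable [Finite N.faces]

theorem toOrdered_toOriented_single_zero {y : Fin 1 → E} (hy : ∃ σ ∈ N.faces, ∀ i, y i ∈ σ) :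
    toOrdered N 0 (toOriented N 0 (Finsupp.single y 1)) = Finsupp.single y 1 := by
  obtain ⟨σ, hσ, hyσ⟩ := hy
  let s : Simplex N 0 := ⟨{y 0}, N.down_closed hσ (by simpa using hyσ 0) (by simp), by simp⟩
  have hs : s.vertex = y := funext fun i => by
    have := s.vertex_mem i
    rw [Subsingleton.elim (α := Fin 1) i 0] at this ⊢
    simpa [s] using this
  rw [← hs, ← toOrdered_single, toOriented_toOrdered]

variable (N M) in
/-- The chain map from the subdivision to the original complex induced by a vertex map. -/
noncomputable def approximation (a : E → E) (k : ℕ) : Chain M k →ₗ[ℝ] Chain N k :=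
  toOriented N k ∘ₗ OChain.push a (k + 1) ∘ₗ toOrdered M k

theorem boundary_approximation (hNM : IsSubdivision N M) {a : E → E}
    (ha : ∀ x ∈ N.space, ∀ σ ∈ N.faces, x ∈ convexHull ℝ (σ : Set E) → a x ∈ σ)
    {k : ℕ} (c : Chain M (k + 1)) :
    boundary N k (approximation N M a (k + 1) c) = approximation N M a k (boundary M k c) := by
  simp only [approximation, LinearMap.comp_apply]
  rw [boundary_toOriented, OChain.bdry_push, bdry_toOrdered]
  refine OChain.map_mem_of_supported (fun x hx => ?_) (toOrdered_mem c)
  obtain ⟨τ, hτ, hxτ⟩ := hx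
  obtain ⟨σ, hσ, -, hτσ⟩ := hNM.vertex_map_mem ha hτ
  rw [OChain.push_single]
  exact Finsupp.single_mem_supported ℝ _ ⟨σ, hσ, fun i => hτσ _ (hxτ i)⟩

/-- The vertex map followed by reordering of the vertices, on augmented ordered chains. -/
noncomputable def reorder (N : Geometry.SimplicialComplex ℝ E) [Finite N.faces] (a : E → E) :
    ∀ n, OChain E n →ₗ[ℝ] OChain E n
  | 0 => LinearMap.id
  | n + 1 => toOrdered N n ∘ₗ toOriented N n ∘ₗ OChain.push a (n + 1)

theorem bdry_reorder {a : E → E} {τ σ : Finset E} (hσ : σ ∈ N.faces) (haτ : ∀ x ∈ τ, a x ∈ σ)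
    (n : ℕ) {c : OChain E (n + 1)} (hc : c ∈ OChain.inSet (τ : Set E) (n + 1)) :
    OChain.bdry n (reorder N a (n + 1) c) = reorder N a n (OChain.bdry n c) := by
  suffices h : (OChain.bdry n ∘ₗ reorder N a (n + 1)) c = (reorder N a n ∘ₗ OChain.bdry n) c from h
  refine OChain.map_eq_of_supported (fun x hx => ?_) hc
  have hx' : ∃ σ ∈ N.faces, ∀ i, a (x i) ∈ σ := ⟨σ, hσ, fun i => haτ _ (hx i)⟩
  cases n with
  | zero =>
    simp only [reorder, LinearMap.comp_apply, OChain.push_single, LinearMap.id_apply]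
    rw [toOrdered_toOriented_single_zero hx', ← OChain.push_single, OChain.bdry_push,
      OChain.push_deg_zero, LinearMap.id_apply]
  | succ n =>
    simp only [reorder, LinearMap.comp_apply]
    rw [bdry_toOrdered, OChain.push_single, boundary_toOriented_single hx', ← OChain.push_single,
      OChain.bdry_push]

theorem reorder_mem_inSet {a : E → E} {τ σ : Finset E} (haτ : ∀ x ∈ τ, a x ∈ σ)
    (hτσ : (τ : Set E) ⊆ convexHull ℝ (σ : Set E)) (n : ℕ) {c : OChain E n}
    (hc : c ∈ OChain.inSet (τ : Set E) n) :
    reorder N a n c ∈ OChain.inSet (convexHull ℝ (σ : Set E)) n := by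
  cases n with
  | zero => exact OChain.inSet_mono hτσ _ hc
  | succ n =>
    exact OChain.inSet_mono (subset_convexHull ℝ _) _
      (toOrdered_toOriented_mem (OChain.push_mem_inSet haτ hc))

variable [Finite M.faces]

/-- A cycle of the subdivision in the kernel of a simplicial approximation is a boundary. -/
theorem exists_boundary_eq_of_approximation_eq_zero (hNM : IsSubdivision N M) {a : E → E}
    (ha : ∀ x ∈ N.space, ∀ σ ∈ N.faces, x ∈ convexHull ℝ (σ : Set E) → a x ∈ σ)
    {k : ℕ} {u : Chain M (k + 1)} (hu : boundary M k u = 0)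
    (hau : approximation N M a (k + 1) u = 0) : ∃ w, boundary M (k + 1) w = u := by
  let c := toOrdered M (k + 1) u
  have hc : c ∈ Finsupp.supported ℝ ℝ {x : Fin (k + 2) → E | ∃ σ ∈ M.faces, ∀ i, x i ∈ σ} :=
    toOrdered_mem u
  have hbc : OChain.bdry (k + 1) c = 0 := by rw [bdry_toOrdered, hu, map_zero]
  -- the first homotopy, inside the simplices of `N`
  let b := OChain.homotopy (reorder N a) (fun _ => LinearMap.id) (k + 2) c
  have hb : OChain.bdry (k + 2) b = -c := by
    have h := OChain.bdry_homotopy_of_supported (F := reorder N a) (G := fun _ => LinearMap.id)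
      rfl (fun τ hτ n c hc => by
        obtain ⟨σ, hσ, -, haτ⟩ := hNM.vertex_map_mem ha hτ
        exact bdry_reorder hσ haτ n hc) (fun _ _ _ _ _ => rfl) hc
    -- On `c` the reordered vertex map factors through the approximation of `u`, which is zero by
    -- hypothesis.
    have h0 : reorder N a (k + 2) c = 0 := by
      have : reorder N a (k + 2) c = toOrdered N (k + 1) (approximation N M a (k + 1) u) := rfl
      rw [this, hau, map_zero]
    rw [h0, hbc, map_zero, sub_zero, zero_sub] at h
    exact h
  -- The vertices of a simplex of `b` share a simplex of `N`, not one of `M`. This places `b` in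
  -- convex subsets of `|M|`, which is all that subdivision needs.
  have hbs : b ∈ Finsupp.supported ℝ ℝ
      {x : Fin (k + 3) → E | ∃ A, Convex ℝ A ∧ A ⊆ M.space ∧ ∀ i, x i ∈ A} := by
    refine OChain.map_mem_of_supported (fun x hx => ?_) hc
    obtain ⟨τ, hτ, hxτ⟩ := hx
    obtain ⟨σ, hσ, hτσ, haτ⟩ := hNM.vertex_map_mem ha hτ
    refine Finsupp.supported_mono ?_ (OChain.homotopy_mem_inSet hτσ
      (fun n c => reorder_mem_inSet haτ hτσ n) (fun n c h => OChain.inSet_mono hτσ n h)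
      (k + 2) (OChain.single_mem_inSet hxτ 1))
    exact fun y hy => ⟨_, convex_convexHull ℝ _,
      (N.convexHull_subset_space hσ).trans hNM.space_eq.ge, hy⟩
  -- the second homotopy, inside the simplices of `M`
  obtain ⟨r, v, hv, hvs⟩ := exists_subdivision_approximation M b hbs
  let T : ∀ n, OChain E n →ₗ[ℝ] OChain E n := fun n => OChain.push v n ∘ₗ OChain.sdIter r n
  have hT0 : T 0 = LinearMap.id := by
    simp only [T, OChain.push_deg_zero, OChain.sdIter_deg_zero, LinearMap.comp_id]
  have hT : ∀ n c, OChain.bdry n (T (n + 1) c) = T n (OChain.bdry n c) := fun n c => by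
    simp only [T, LinearMap.comp_apply, OChain.bdry_push, OChain.bdry_sdIter]
  have hTτ : ∀ τ ∈ M.faces, ∀ n, ∀ c ∈ OChain.inSet (τ : Set E) n,
      T n c ∈ OChain.inSet (τ : Set E) n := fun τ hτ n c hc =>
    OChain.push_mem_inSet
      (fun x hx => hv x (M.convexHull_subset_space hτ hx) τ hτ hx)
      (OChain.sdIter_mem_inSet (convex_convexHull ℝ _) r n
        (OChain.inSet_mono (subset_convexHull ℝ _) n hc))
  let d := OChain.homotopy T (fun _ => LinearMap.id) (k + 2) c
  have hd : OChain.bdry (k + 2) d = T (k + 2) c - c := by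
    have h := OChain.bdry_homotopy_of_supported (F := T) (G := fun _ => LinearMap.id) hT0
      (fun _ _ n c _ => hT n c) (fun _ _ _ _ _ => rfl) hc
    rw [hbc, map_zero, sub_zero] at h
    exact h
  have hds : d ∈ Finsupp.supported ℝ ℝ
      {x : Fin (k + 3) → E | ∃ σ ∈ M.faces, ∀ i, x i ∈ σ} := by
    refine OChain.map_mem_of_supported (fun x hx => ?_) hc
    obtain ⟨τ, hτ, hxτ⟩ := hx
    refine Finsupp.supported_mono ?_ (OChain.homotopy_mem_inSet (A := (τ : Set E)) subset_rfl
      (hTτ τ hτ) (fun _ _ h => h) (k + 2) (OChain.single_mem_inSet hxτ 1))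
    exact fun y hy => ⟨τ, hτ, hy⟩
  refine ⟨toOriented M (k + 2) (-(T (k + 3) b + d)), ?_⟩
  have hmem := neg_mem (add_mem (show T (k + 3) b ∈ _ from hvs) hds)
  -- The boundary is `-(T (-c) + (T c - c)) = c`.
  have hbdry : OChain.bdry (k + 2) (-(T (k + 3) b + d)) = c := by
    rw [map_neg, map_add, hT, hb, hd, map_neg]
    abel
  rw [boundary_toOriented hmem, hbdry, toOriented_toOrdered]

/-- A simplicial approximation is a left inverse of the inclusion. -/
theorem approximation_inclusion (hNM : IsSubdivision N M) {a : E → E}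
    (ha : ∀ x ∈ N.space, ∀ σ ∈ N.faces, x ∈ convexHull ℝ (σ : Set E) → a x ∈ σ)
    (hcomm : ∀ k x, boundary M k (inclusion N M (k + 1) x) = inclusion N M k (boundary N k x))
    (k : ℕ) (x : Chain N k) : approximation N M a k (inclusion N M k x) = x := by
  suffices h : approximation N M a k ∘ₗ inclusion N M k = LinearMap.id from
    LinearMap.congr_fun h x
  clear x
  induction k with
  | zero =>
    refine Finsupp.lhom_ext' fun σ => LinearMap.ext_ring ?_
    obtain ⟨τ, hτσ, hi⟩ := inclusion_single_zero hNM σ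
    simp only [LinearMap.comp_apply, Finsupp.lsingle_apply, LinearMap.id_apply]
    rw [hi, approximation, LinearMap.comp_apply, LinearMap.comp_apply, toOrdered_single,
      OChain.push_single]
    have h : (fun i => a (τ.vertex i)) = σ.vertex := by
      obtain ⟨v, hv⟩ := Finset.card_eq_one.1 σ.2.2
      funext i
      have h1 : a (τ.vertex i) ∈ σ.1 := by
        have hmem : τ.vertex i ∈ convexHull ℝ (σ.1 : Set E) :=
          subset_convexHull ℝ _ (by rw [← hτσ]; exact τ.vertex_mem i)
        exact ha _ (N.convexHull_subset_space σ.2.1 hmem) _ σ.2.1 hmem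
      have h2 := σ.vertex_mem i
      rw [hv, Finset.mem_singleton] at h1 h2
      rw [h1, h2]
    rw [h, ← toOrdered_single, toOriented_toOrdered]
  | succ k ih =>
    refine Finsupp.lhom_ext' fun σ => LinearMap.ext_ring ?_
    simp only [LinearMap.comp_apply, Finsupp.lsingle_apply, LinearMap.id_apply]
    set z := approximation N M a (k + 1) (inclusion N M (k + 1) (Finsupp.single σ 1)) with hz
    -- The vertex map sends points of `|σ|` to vertices of `σ`, so `z` is a multiple of `σ`. Its
    -- boundary is that of `σ` by induction, which makes the multiple `1` without a Sperner-type
    -- count.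
    have hsupp : z ∈ Finsupp.supported ℝ ℝ {σ} := by
      rw [hz]
      refine OChain.map_mem_of_supported (F := approximation N M a (k + 1))
        (U := Finsupp.supported ℝ ℝ {σ}) (S := {τ : Simplex M (k + 1) |
        (τ.1 : Set E) ⊆ convexHull ℝ (σ.1 : Set E)}) (fun τ hτ s hs => ?_) fun τ hτ => ?_
      · rw [approximation, LinearMap.comp_apply, LinearMap.comp_apply, toOrdered_single,
          OChain.push_single, Finset.mem_coe, Finsupp.mem_support_iff, toOriented_single] at hs
        have hr := range_eq_of_tupleDet_ne_zero hs
        refine Simplex.ext_of_subset fun y hy => ?_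
        obtain ⟨j, rfl⟩ := s.mem_iff.1 hy
        obtain ⟨i, hi⟩ := (Set.ext_iff.1 hr (s.vertex j)).2 ⟨j, rfl⟩
        rw [← hi]
        have hmem := hτ (τ.vertex_mem i)
        exact ha _ (N.convexHull_subset_space σ.2.1 hmem) _ σ.2.1 hmem
      · rw [Finset.mem_coe, Finsupp.mem_support_iff, inclusion_single_apply] at hτ
        by_contra h
        exact hτ (orientationSign_eq_zero h)
    obtain ⟨r, hr⟩ : ∃ r : ℝ, z = r • Finsupp.single σ 1 := by
      refine ⟨z σ, ?_⟩
      rw [Finsupp.smul_single, smul_eq_mul, mul_one]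
      exact Finsupp.support_subset_singleton.1 fun s hs => by simpa using hsupp hs
    have hb : boundary N k z = boundary N k (Finsupp.single σ 1) := by
      rw [hz, boundary_approximation hNM ha, hcomm]
      exact LinearMap.congr_fun ih _
    have hr1 := congrArg (fun c => c (σ.face 0)) hb
    simp only [hr, map_smul, Finsupp.smul_apply, boundary_single_face_zero, smul_eq_mul,
      mul_one] at hr1
    rw [hr, hr1, one_smul]

/-- The cokernel of the inclusion is acyclic in positive degrees. -/
theorem exists_eq_inclusion_add_boundary (hNM : IsSubdivision N M)
    (hcomm : ∀ k x, boundary M k (inclusion N M (k + 1) x) = inclusion N M k (boundary N k x))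
    (k : ℕ) (v : Chain M (k + 1)) (x : Chain N k) (hv : boundary M k v = inclusion N M k x) :
    ∃ y w, v = inclusion N M (k + 1) y + boundary M (k + 1) w := by
  obtain ⟨a, ha⟩ := exists_vertex_map N
  have hid := approximation_inclusion hNM ha hcomm
  -- Subtracting `i (a v)` from `v` gives a cycle killed by `a`, both because `a ∘ i = id`.
  obtain ⟨w, hw⟩ := exists_boundary_eq_of_approximation_eq_zero hNM ha
    (u := v - inclusion N M (k + 1) (approximation N M a (k + 1) v))
    (by rw [map_sub, hcomm, boundary_approximation hNM ha, hv, hid, sub_self])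
    (by rw [map_sub, hid, sub_self])
  exact ⟨_, w, by rw [hw]; abel⟩

theorem inclusion_injective (hNM : IsSubdivision N M)
    (hcomm : ∀ k x, boundary M k (inclusion N M (k + 1) x) = inclusion N M k (boundary N k x))
    (k : ℕ) : Function.Injective (inclusion N M k) := by
  obtain ⟨a, ha⟩ := exists_vertex_map N
  exact Function.LeftInverse.injective (approximation_inclusion hNM ha hcomm k)

end Approximation

/-! ### Barycentric coordinates, sides of a hyperplane, germs of segments -/

section Coordinates

variable {E : Type*} [AddCommGroup E] [Module ℝ E]

/-- The affine functions `L i` are barycentric coordinates for the points `s i`. -/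
def IsCoords {n : ℕ} (s : Fin n → E) (L : Fin n → E →ᵃ[ℝ] ℝ) : Prop :=
  ∀ i j, L i (s j) = if i = j then 1 else 0

namespace IsCoords

variable {n : ℕ} {s : Fin n → E} {L : Fin n → E →ᵃ[ℝ] ℝ}

theorem apply_sum (hL : IsCoords s L) {w : Fin n → ℝ} (hw : ∑ i, w i = 1) (i : Fin n) :
    L i (∑ j, w j • s j) = w i := by
  rw [map_sum_of_sum_eq_one _ _ _ _ hw, Finset.sum_eq_single i]
  · simp [hL i i]
  · intro j _ hj
    simp [hL i j, hj.symm]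
  · simp

theorem exists_weights {x : E} (hx : x ∈ convexHull ℝ (Set.range s)) :
    ∃ w : Fin n → ℝ, (∀ i, 0 ≤ w i) ∧ ∑ i, w i = 1 ∧ ∑ i, w i • s i = x := by
  rw [convexHull_range_eq_exists_affineCombination] at hx
  obtain ⟨t, w, hw0, hw1, rfl⟩ := hx
  classical
  refine ⟨fun i => if i ∈ t then w i else 0, fun i => ?_, ?_, ?_⟩
  · dsimp only
    split_ifs with h
    · exact hw0 i h
    · exact le_rfl
  · simpa using hw1
  · rw [t.affineCombination_eq_linear_combination _ _ hw1]
    simp [ite_smul]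

theorem nonneg (hL : IsCoords s L) {x : E} (hx : x ∈ convexHull ℝ (Set.range s)) (i : Fin n) :
    0 ≤ L i x := by
  obtain ⟨w, hw0, hw1, rfl⟩ := exists_weights hx
  rw [hL.apply_sum hw1]
  exact hw0 i

theorem sum_eq_one (hL : IsCoords s L) {x : E} (hx : x ∈ convexHull ℝ (Set.range s)) :
    ∑ i, L i x = 1 := by
  obtain ⟨w, hw0, hw1, rfl⟩ := exists_weights hx
  rw [← hw1]
  exact Finset.sum_congr rfl fun i _ => hL.apply_sum hw1 i

theorem sum_smul (hL : IsCoords s L) {x : E} (hx : x ∈ convexHull ℝ (Set.range s)) :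
    ∑ i, L i x • s i = x := by
  obtain ⟨w, hw0, hw1, rfl⟩ := exists_weights hx
  exact Finset.sum_congr rfl fun i _ => by rw [hL.apply_sum hw1 i]

theorem sum_smul_mem {w : Fin n → ℝ} (hw : ∑ i, w i = 1) (hw0 : ∀ i, 0 ≤ w i) :
    ∑ i, w i • s i ∈ convexHull ℝ (Set.range s) :=
  (convex_convexHull ℝ _).sum_mem (fun i _ => hw0 i) hw
    fun i _ => subset_convexHull ℝ _ (Set.mem_range_self i)

/-- Coordinates sum to `1`, so a linear relation between coordinate rows has coefficient sum `0` and
is an affine relation between the points. -/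
theorem linearIndependent (hL : IsCoords s L) {m : ℕ} {x : Fin m → E}
    (hx : AffineIndependent ℝ x) (hxs : ∀ a, x a ∈ convexHull ℝ (Set.range s)) :
    LinearIndependent ℝ (fun a i => L i (x a) : Fin m → Fin n → ℝ) := by
  rw [Fintype.linearIndependent_iff]
  intro c hc
  have hci : ∀ i, ∑ a, c a * L i (x a) = 0 := fun i => by
    simpa [Finset.sum_apply] using congrFun hc i
  have h1 : ∑ a, c a = 0 := by
    calc ∑ a, c a = ∑ a, ∑ i, c a * L i (x a) := by
          refine Finset.sum_congr rfl fun a _ => ?_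
          rw [← Finset.mul_sum, hL.sum_eq_one (hxs a), mul_one]
      _ = 0 := by
          rw [Finset.sum_comm]
          exact Finset.sum_eq_zero fun i _ => hci i
  have h2 : ∑ a, c a • x a = 0 := by
    calc ∑ a, c a • x a = ∑ a, ∑ i, (c a * L i (x a)) • s i := by
          refine Finset.sum_congr rfl fun a _ => ?_
          conv_lhs => rw [← hL.sum_smul (hxs a), Finset.smul_sum]
          exact Finset.sum_congr rfl fun i _ => smul_smul _ _ _
      _ = 0 := by
          rw [Finset.sum_comm]
          refine Finset.sum_eq_zero fun i _ => ?_
          rw [← Finset.sum_smul, hci, zero_smul]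
  exact fun a => affineIndependent_iff.1 hx Finset.univ c h1 h2 a (Finset.mem_univ a)

end IsCoords

/-- The determinant of barycentric coordinates of a point `x` followed by the points `r a`, as an
affine function of `x`. Its sign tells the sides of the hyperplane through the `r a`. -/
noncomputable def side {n : ℕ} (L : Fin (n + 1) → E →ᵃ[ℝ] ℝ) (r : Fin n → E) : E →ᵃ[ℝ] ℝ :=
  (Fintype.linearCombination ℝ fun i : Fin (n + 1) => (-1 : ℝ) ^ (i : ℕ) *
    (Matrix.of fun a b => L (i.succAbove b) (r a)).det).toAffineMap.comp (AffineMap.pi L)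

theorem side_apply {n : ℕ} (L : Fin (n + 1) → E →ᵃ[ℝ] ℝ) (r : Fin n → E) (x : E) :
    side L r x = ∑ i : Fin (n + 1), L i x * ((-1 : ℝ) ^ (i : ℕ) *
      (Matrix.of fun a b => L (i.succAbove b) (r a)).det) := by
  simp [side, Fintype.linearCombination_apply]

theorem side_eq_det {n : ℕ} (L : Fin (n + 1) → E →ᵃ[ℝ] ℝ) (r : Fin n → E) (x : E) :
    side L r x = (Matrix.of (Fin.cons (fun i => L i x) fun a i => L i (r a)) :
      Matrix (Fin (n + 1)) (Fin (n + 1)) ℝ).det := by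
  rw [side_apply, Matrix.det_succ_row_zero]
  refine Finset.sum_congr rfl fun i _ => ?_
  rw [mul_left_comm, mul_assoc]
  rfl

theorem side_apply_self {n : ℕ} (L : Fin (n + 1) → E →ᵃ[ℝ] ℝ) (r : Fin n → E) (a : Fin n) :
    side L r (r a) = 0 := by
  rw [side_eq_det]
  exact Matrix.det_zero_of_row_eq (Fin.succ_ne_zero a).symm (by ext; simp)

/-- A nonzero side makes the coordinate matrix of `y` and the `r a` invertible, and its inverse
supplies the coefficients. As `side` is affine and vanishes at every `r a`, only `c₀` survives. -/
theorem IsCoords.exists_combination {n : ℕ} {s : Fin (n + 1) → E} {L : Fin (n + 1) → E →ᵃ[ℝ] ℝ}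
    (hL : IsCoords s L) {r : Fin n → E} (hr : ∀ a, r a ∈ convexHull ℝ (Set.range s)) {y x : E}
    (hy : y ∈ convexHull ℝ (Set.range s)) (hx : x ∈ convexHull ℝ (Set.range s))
    (hside : side L r y ≠ 0) :
    ∃ (c₀ : ℝ) (c : Fin n → ℝ), c₀ + ∑ a, c a = 1 ∧ c₀ • y + ∑ a, c a • r a = x ∧
      side L r x = c₀ * side L r y := by
  let z : Fin (n + 1) → E := Fin.cons y r
  let B : Matrix (Fin (n + 1)) (Fin (n + 1)) ℝ := Matrix.of fun a i => L i (z a)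
  have hB : side L r y = B.det := by
    rw [side_eq_det]
    congr 1
    ext a i
    refine Fin.cases ?_ (fun a => ?_) a <;> simp [B, z]
  have hz : ∀ a, z a ∈ convexHull ℝ (Set.range s) := fun a => by
    refine Fin.cases ?_ (fun a => ?_) a
    · simpa [z] using hy
    · simpa [z] using hr a
  have hunit : IsUnit B.det := isUnit_iff_ne_zero.2 (hB ▸ hside)
  let c : Fin (n + 1) → ℝ := Matrix.vecMul (fun i => L i x) B⁻¹
  have hc : Matrix.vecMul c B = fun i => L i x := by
    rw [Matrix.vecMul_vecMul, Matrix.nonsing_inv_mul _ hunit, Matrix.vecMul_one]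
  have hci : ∀ i, ∑ a, c a * L i (z a) = L i x := fun i => congrFun hc i
  have h1 : ∑ a, c a = 1 := by
    calc ∑ a, c a = ∑ a, ∑ i, c a * L i (z a) := by
          refine Finset.sum_congr rfl fun a _ => ?_
          rw [← Finset.mul_sum, hL.sum_eq_one (hz a), mul_one]
      _ = 1 := by
          rw [Finset.sum_comm, Finset.sum_congr rfl fun i _ => hci i, hL.sum_eq_one hx]
  have h2 : ∑ a, c a • z a = x := by
    calc ∑ a, c a • z a = ∑ a, ∑ i, (c a * L i (z a)) • s i := by
          refine Finset.sum_congr rfl fun a _ => ?_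
          conv_lhs => rw [← hL.sum_smul (hz a), Finset.smul_sum]
          exact Finset.sum_congr rfl fun i _ => smul_smul _ _ _
      _ = x := by
          rw [Finset.sum_comm, ← hL.sum_smul hx]
          refine Finset.sum_congr rfl fun i _ => ?_
          rw [← Finset.sum_smul, hci]
  refine ⟨c 0, fun a => c a.succ, ?_, ?_, ?_⟩
  · rw [← h1, Fin.sum_univ_succ]
  · rw [← h2, Fin.sum_univ_succ]
    simp [z]
  · rw [← h2, map_sum_of_sum_eq_one _ _ _ _ h1, Fin.sum_univ_succ]
    simp [z, side_apply_self]

theorem exists_small_lineMap_pos {ι : Type*} [Finite ι] {P : ι → ℝ} (Q : ι → ℝ) (hP : ∀ i, 0 < P i) :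
    ∃ t : ℝ, 0 < t ∧ t < 1 ∧ ∀ i, 0 < (1 - t) * P i + t * Q i := by
  have h : ∀ᶠ t in nhds (0 : ℝ), t < 1 ∧ ∀ i, 0 < (1 - t) * P i + t * Q i := by
    refine (gt_mem_nhds one_pos).and (Filter.eventually_all.2 fun i => ?_)
    have hc : Continuous fun t : ℝ => (1 - t) * P i + t * Q i := by fun_prop
    exact hc.continuousAt.eventually (lt_mem_nhds (by simpa using hP i))
  obtain ⟨t, ht, ht0⟩ := ((h.filter_mono nhdsWithin_le_nhds).and
    (self_mem_nhdsWithin (s := Set.Ioi (0 : ℝ)))).exists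
  exact ⟨t, ht0, ht.1, ht.2⟩

theorem smul_lineMap_add_smul_lineMap (x y : E) {α β t u : ℝ} (h : α + β = 1)
    (h' : α * t + β * u = 0) :
    α • AffineMap.lineMap (k := ℝ) x y t + β • AffineMap.lineMap (k := ℝ) x y u = x := by
  rw [AffineMap.lineMap_apply_module, AffineMap.lineMap_apply_module]
  have : α • ((1 - t) • x + t • y) + β • ((1 - u) • x + u • y) =
      (α + β - (α * t + β * u)) • x + (α * t + β * u) • y := by module
  rw [this, h', h]
  simp

/-- An initial piece of a segment in a finite simplicial complex lies in a single simplex. -/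
theorem exists_face_germ (K : Geometry.SimplicialComplex ℝ E) [Finite K.faces] {p q : E}
    (h : ∀ t : ℝ, 0 < t → t ≤ 1 → AffineMap.lineMap p q t ∈ K.space) :
    ∃ τ ∈ K.faces, p ∈ convexHull ℝ (τ : Set E) ∧ ∃ t : ℝ, 0 < t ∧ t ≤ 1 ∧
      ∃ w : E → ℝ, (∀ y ∈ τ, 0 < w y) ∧ ∑ y ∈ τ, w y = 1 ∧
        ∑ y ∈ τ, w y • y = AffineMap.lineMap p q t := by
  -- Sampling at `1 / (n + 1)`, one simplex is the carrier of infinitely many sample points. With no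
  -- topology on `E`, the endpoint `p` is placed in it through coordinates instead of closedness.
  let t : ℕ → ℝ := fun n => 1 / ((n : ℝ) + 1)
  have ht0 : ∀ n, 0 < t n := fun n => by positivity
  have ht1 : ∀ n, t n ≤ 1 := fun n => by
    rw [div_le_one (by positivity)]
    linarith [(Nat.cast_nonneg n : (0 : ℝ) ≤ n)]
  choose f hf hmin w hw hw1 hwx using fun n => exists_carrier (h (t n) (ht0 n) (ht1 n))
  obtain ⟨⟨τ, hτ⟩, hinf⟩ := Finite.exists_infinite_fiber fun n => (⟨f n, hf n⟩ : K.faces)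
  have hinf' : {n | f n = τ}.Infinite := by
    rw [Set.infinite_coe_iff] at hinf
    refine hinf.mono fun n hn => ?_
    simpa using hn
  obtain ⟨n₀, hn₀⟩ := hinf'.nonempty
  obtain ⟨n₁, hn₁, hlt⟩ := hinf'.exists_gt n₀
  have hn₀ : f n₀ = τ := hn₀
  have hn₁ : f n₁ = τ := hn₁
  refine ⟨τ, hτ, ?_, t n₀, ht0 _, ht1 _, w n₀, hn₀ ▸ hw n₀, hn₀ ▸ hw1 n₀, hn₀ ▸ hwx n₀⟩
  obtain ⟨l, h1, h0⟩ := exists_barycentric_coords (K.indep hτ)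
  have hmem : ∀ n, f n = τ → AffineMap.lineMap p q (t n) ∈ convexHull ℝ (τ : Set E) := by
    intro n hn
    exact Finset.mem_convexHull'.2 ⟨w n, fun y hy => (hw n y (hn.symm ▸ hy)).le, hn ▸ hw1 n,
      hn ▸ hwx n⟩
  -- At a sample point the coordinate is `(n * l y p + l y q) / (n + 1)`, which would be negative
  -- for large `n` if `l y p` were.
  have hl0 : ∀ y ∈ τ, 0 ≤ l y p := by
    intro y hy
    by_contra! hneg
    obtain ⟨m, hm⟩ := exists_nat_gt (l y q / (-l y p))
    obtain ⟨n, hn, hmn⟩ := hinf'.exists_gt m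
    have hge := coords_nonneg h1 h0 (hmem n hn) hy
    rw [AffineMap.apply_lineMap, AffineMap.lineMap_apply_module, smul_eq_mul, smul_eq_mul] at hge
    have hq : l y q < m * (-l y p) := by rwa [div_lt_iff₀ (by linarith)] at hm
    have hn1 : (m : ℝ) < n := by exact_mod_cast hmn
    have hpos : (0 : ℝ) < n + 1 := by positivity
    have h3 : (1 - t n) * l y p + t n * l y q = (n * l y p + l y q) / (n + 1) := by
      simp only [t]
      field_simp
      ring
    rw [h3, le_div_iff₀ hpos] at hge
    nlinarith
  have hcoord : ∀ n, f n = τ → ∑ y ∈ τ, l y (AffineMap.lineMap p q (t n)) = 1 ∧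
      ∑ y ∈ τ, l y (AffineMap.lineMap p q (t n)) • y = AffineMap.lineMap p q (t n) := by
    intro n hn
    have hw1' : ∑ y ∈ τ, w n y = 1 := hn ▸ hw1 n
    have hwx' : ∑ y ∈ τ, w n y • y = AffineMap.lineMap p q (t n) := hn ▸ hwx n
    have hlw : ∀ y ∈ τ, l y (AffineMap.lineMap p q (t n)) = w n y := by
      intro y hy
      rw [← hwx', map_sum_of_sum_eq_one _ _ _ _ hw1', Finset.sum_eq_single y]
      · rw [h1 y hy, smul_eq_mul, mul_one]
      · intro z hz hzy
        rw [h0 y hy z hz hzy.symm, smul_zero]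
      · exact fun h => absurd hy h
    rw [Finset.sum_congr rfl hlw, hw1', Finset.sum_congr rfl fun y hy => by rw [hlw y hy], hwx']
    exact ⟨rfl, rfl⟩
  have htne : t n₀ - t n₁ ≠ 0 := by
    have : t n₁ < t n₀ := one_div_lt_one_div_of_lt (by positivity) (by
      have : (n₀ : ℝ) < n₁ := by exact_mod_cast hlt
      linarith)
    linarith
  obtain ⟨hs0, hv0⟩ := hcoord n₀ hn₀
  obtain ⟨hs1, hv1⟩ := hcoord n₁ hn₁
  -- `p` is an affine combination of two points of the segment
  let α : ℝ := -t n₁ / (t n₀ - t n₁)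
  let β : ℝ := t n₀ / (t n₀ - t n₁)
  have hαβ : α + β = 1 := by simp only [α, β]; field_simp; ring
  have hαt : α * t n₀ + β * t n₁ = 0 := by simp only [α, β]; field_simp; ring
  have hlp : ∀ y, l y p = α * l y (AffineMap.lineMap p q (t n₀)) +
      β * l y (AffineMap.lineMap p q (t n₁)) := by
    intro y
    rw [AffineMap.apply_lineMap, AffineMap.apply_lineMap]
    exact (smul_lineMap_add_smul_lineMap (l y p) (l y q) hαβ hαt).symm
  refine Finset.mem_convexHull'.2 ⟨fun y => l y p, hl0, ?_, ?_⟩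
  · simp only [hlp, Finset.sum_add_distrib, ← Finset.mul_sum, hs0, hs1, mul_one, hαβ]
  · simp only [hlp, add_smul, Finset.sum_add_distrib, mul_smul, ← Finset.smul_sum, hv0, hv1]
    exact smul_lineMap_add_smul_lineMap p q hαβ hαt

end Coordinates

theorem det_ne_zero_of_linearIndependent {n : ℕ} {r : Fin n → Fin n → ℝ}
    (h : LinearIndependent ℝ r) : (Matrix.of r).det ≠ 0 := by
  have : IsUnit (Matrix.of r) := Matrix.linearIndependent_rows_iff_isUnit.1 h
  exact ((Matrix.isUnit_iff_isUnit_det _).1 this).ne_zero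

theorem neg_one_pow_mul_sign (j : ℕ) (d : ℝ) :
    (-1 : ℝ) ^ j * Real.sign d = Real.sign ((-1) ^ j * d) := by
  rcases neg_one_pow_eq_or ℝ j with h | h <;> simp [h, Real.sign_neg]

/-! ### Local count of cofaces: the induced map commutes with the boundary -/

section InclusionChainMap

variable {E : Type*} [AddCommGroup E] [Module ℝ E] [LinearOrder E]

section Simplex

variable {K : Geometry.SimplicialComplex ℝ E}

theorem Simplex.affineIndependent {k : ℕ} (s : Simplex K k) : AffineIndependent ℝ s.vertex :=
  (K.indep s.2.1).comp_embedding
    ⟨fun i => (⟨s.vertex i, s.vertex_mem i⟩ : s.1), fun _ _ h =>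
      s.vertex_injective (congrArg Subtype.val h)⟩

theorem Simplex.isCoords {k : ℕ} (s : Simplex K k) {l : E → E →ᵃ[ℝ] ℝ}
    (h1 : ∀ y ∈ s.1, l y y = 1) (h0 : ∀ y ∈ s.1, ∀ z ∈ s.1, y ≠ z → l y z = 0) :
    IsCoords s.vertex fun i => l (s.vertex i) := by
  intro i j
  split_ifs with h
  · rw [h]
    exact h1 _ (s.vertex_mem j)
  · exact h0 _ (s.vertex_mem i) _ (s.vertex_mem j) fun h' => h (s.vertex_injective h')

theorem Simplex.exists_isCoords {k : ℕ} (s : Simplex K k) : ∃ L, IsCoords s.vertex L := by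
  obtain ⟨l, h1, h0⟩ := exists_barycentric_coords (K.indep s.2.1)
  exact ⟨_, s.isCoords h1 h0⟩

theorem IsCoords.face {k : ℕ} {s : Simplex K (k + 1)} {L : Fin (k + 2) → E →ᵃ[ℝ] ℝ}
    (hL : IsCoords s.vertex L) (i : Fin (k + 2)) :
    IsCoords (s.face i).vertex fun c => L (i.succAbove c) := by
  intro a b
  simp only [s.face_vertex, hL (i.succAbove a), (Fin.succAbove_right_injective).eq_iff]

theorem IsCoords.apply_eq_zero_of_mem_face {k : ℕ} {s : Simplex K (k + 1)}
    {L : Fin (k + 2) → E →ᵃ[ℝ] ℝ} (hL : IsCoords s.vertex L) {i : Fin (k + 2)} {x : E}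
    (hx : x ∈ convexHull ℝ (Set.range (s.face i).vertex)) : L i x = 0 := by
  obtain ⟨w, -, hw1, rfl⟩ := IsCoords.exists_weights hx
  rw [map_sum_of_sum_eq_one _ _ _ _ hw1]
  refine Finset.sum_eq_zero fun c _ => ?_
  rw [s.face_vertex, hL, if_neg (Fin.succAbove_ne i c).symm, smul_zero]

theorem IsCoords.mem_face_of_apply_eq_zero {k : ℕ} {s : Simplex K (k + 1)}
    {L : Fin (k + 2) → E →ᵃ[ℝ] ℝ} (hL : IsCoords s.vertex L) {i : Fin (k + 2)} {x : E}
    (hx : x ∈ convexHull ℝ (Set.range s.vertex)) (h : L i x = 0) :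
    x ∈ convexHull ℝ (Set.range (s.face i).vertex) := by
  have h1 := hL.sum_eq_one hx
  have h2 := hL.sum_smul hx
  rw [Fin.sum_univ_succAbove _ i, h, zero_add] at h1
  rw [Fin.sum_univ_succAbove _ i, h, zero_smul, zero_add] at h2
  rw [← h2]
  simp only [← s.face_vertex]
  exact IsCoords.sum_smul_mem h1 fun c => hL.nonneg hx _

end Simplex

variable {N M : Geometry.SimplicialComplex ℝ E}

theorem IsBarycentricMatrix.eq_coords {E : Type*} [AddCommGroup E] [Module ℝ E] {k : ℕ} {v w : Fin (k + 1) → E}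
    {B : Matrix (Fin (k + 1)) (Fin (k + 1)) ℝ} (hB : IsBarycentricMatrix v w B)
    {L : Fin (k + 1) → E →ᵃ[ℝ] ℝ} (hL : IsCoords v L) :
    B = Matrix.of fun i j => L j (w i) := by
  ext i j
  rw [Matrix.of_apply, hB.2.2 i, hL.apply_sum (hB.2.1 i)]

/-- Barycentric matrices are unique, so both existential conditions in the definition concern the
same determinant. -/
theorem orientationSign_eq_sign {k : ℕ} {σ : Simplex N k} {τ : Simplex M k}
    {L : Fin (k + 1) → E →ᵃ[ℝ] ℝ} (hL : IsCoords σ.vertex L)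
    (h : ∀ i, τ.vertex i ∈ convexHull ℝ (Set.range σ.vertex)) :
    orientationSign σ τ = Real.sign (Matrix.of fun i j => L j (τ.vertex i)).det := by
  have hB : IsBarycentricMatrix σ.vertex τ.vertex (Matrix.of fun i j => L j (τ.vertex i)) :=
    ⟨fun i j => hL.nonneg (h i) j, fun i => hL.sum_eq_one (h i), fun i => (hL.sum_smul (h i)).symm⟩
  have hpos : (∃ B, IsBarycentricMatrix σ.vertex τ.vertex B ∧ 0 < B.det) ↔
      0 < (Matrix.of fun i j => L j (τ.vertex i)).det :=
    ⟨fun ⟨B, h1, h2⟩ => h1.eq_coords hL ▸ h2, fun h => ⟨_, hB, h⟩⟩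
  have hneg : (∃ B, IsBarycentricMatrix σ.vertex τ.vertex B ∧ B.det < 0) ↔
      (Matrix.of fun i j => L j (τ.vertex i)).det < 0 :=
    ⟨fun ⟨B, h1, h2⟩ => h1.eq_coords hL ▸ h2, fun h => ⟨_, hB, h⟩⟩
  rw [orientationSign]
  simp only [hpos, hneg]
  rcases lt_trichotomy (Matrix.of fun i j => L j (τ.vertex i)).det 0 with h | h | h
  · rw [if_neg h.not_gt, if_pos h, Real.sign_of_neg h]
  · rw [h]
    simp
  · rw [if_pos h, Real.sign_of_pos h]

theorem orientationSign_eq_zero' {k : ℕ} {σ : Simplex N k} {τ : Simplex M k}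
    (h : ¬ ∀ i, τ.vertex i ∈ convexHull ℝ (Set.range σ.vertex)) : orientationSign σ τ = 0 := by
  refine orientationSign_eq_zero fun h' => h fun i => ?_
  rw [σ.range_vertex]
  exact h' (τ.vertex_mem i)

section Side

variable {k : ℕ} {σ : Simplex N (k + 1)} {L : Fin (k + 2) → E →ᵃ[ℝ] ℝ} {ρ : Simplex M k}

/-- Expansion along row `j`, that of the vertex missing from `ρ`: incidence sign times orientation
is the side of `ρ` on which that vertex lies. -/
theorem neg_one_pow_mul_orientationSign (hL : IsCoords σ.vertex L) {τ : Simplex M (k + 1)}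
    {j : Fin (k + 2)} (hτρ : τ.face j = ρ)
    (hτ : ∀ i, τ.vertex i ∈ convexHull ℝ (Set.range σ.vertex)) :
    (-1 : ℝ) ^ (j : ℕ) * orientationSign σ τ = Real.sign (side L ρ.vertex (τ.vertex j)) := by
  rw [orientationSign_eq_sign hL hτ, neg_one_pow_mul_sign, side_apply, Matrix.det_succ_row _ j,
    Finset.mul_sum]
  congr 1
  refine Finset.sum_congr rfl fun i _ => ?_
  have hminor : (Matrix.of fun i j => L j (τ.vertex i)).submatrix j.succAbove i.succAbove =
      Matrix.of fun a b => L (i.succAbove b) (ρ.vertex a) := by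
    ext a b
    simp [← hτρ, τ.face_vertex]
  have hsign : (-1 : ℝ) ^ (j : ℕ) * (-1) ^ ((j : ℕ) + i) = (-1) ^ (i : ℕ) := by
    rw [pow_add, ← mul_assoc, ← mul_pow]
    simp
  rw [hminor, ← hsign, Matrix.of_apply]
  ring

theorem side_combination_self (L : Fin (k + 2) → E →ᵃ[ℝ] ℝ) (ρ : Simplex M k)
    {w : Fin (k + 1) → ℝ} (hw : ∑ a, w a = 1) :
    side L ρ.vertex (∑ a, w a • ρ.vertex a) = 0 := by
  rw [map_sum_of_sum_eq_one _ _ _ _ hw]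
  exact Finset.sum_eq_zero fun a _ => by rw [side_apply_self, smul_zero]

theorem sum_inv_card_eq_one (k : ℕ) : ∑ _a : Fin (k + 1), ((k : ℝ) + 1)⁻¹ = 1 := by
  simp
  field_simp

/-- At most one coface of `ρ` lies on each side of `ρ` in `σ`. -/
theorem eq_of_side_mul_pos (hL : IsCoords σ.vertex L) {τ τ' : Simplex M (k + 1)}
    {j j' : Fin (k + 2)} (hj : τ.face j = ρ) (hj' : τ'.face j' = ρ)
    (hτ : ∀ i, τ.vertex i ∈ convexHull ℝ (Set.range σ.vertex))
    (hτ' : ∀ i, τ'.vertex i ∈ convexHull ℝ (Set.range σ.vertex))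
    (hside : 0 < side L ρ.vertex (τ.vertex j) * side L ρ.vertex (τ'.vertex j')) :
    τ = τ' ∧ j = j' := by
  refine Simplex.eq_of_face_eq hj hj' ?_
  by_contra hne
  have hρτ : ρ.1 ⊆ τ.1 := by rw [τ.val_eq_insert hj]; exact Finset.subset_insert _ _
  have hρτ' : ρ.1 ⊆ τ'.1 := by rw [τ'.val_eq_insert hj']; exact Finset.subset_insert _ _
  have hρσ : ∀ a, ρ.vertex a ∈ convexHull ℝ (Set.range σ.vertex) := fun a => by
    rw [← hj, τ.face_vertex]
    exact hτ _
  have hwτ' : τ.vertex j ∉ τ'.1 := by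
    rw [τ'.val_eq_insert hj', Finset.mem_insert]
    rintro (h | h)
    · exact hne h
    · exact τ.vertex_notMem_face hj h
  -- Being on the same side means `c₀ > 0`. A short step from the barycenter `p` of `ρ` towards
  -- `τ.vertex j` therefore stays in `τ'` as well as in `τ`.
  obtain ⟨c₀, c, hc1, hcw, hcs⟩ := hL.exists_combination hρσ (hτ' j') (hτ j)
    (fun h => by simp [h] at hside)
  have hc₀ : 0 < c₀ := by
    rw [hcs, mul_assoc] at hside
    exact lt_of_mul_lt_mul_right (by rwa [zero_mul]) (mul_self_nonneg _)
  let β : ℝ := ((k : ℝ) + 1)⁻¹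
  have hβ : 0 < β := by positivity
  obtain ⟨t, ht0, ht1, ht⟩ := exists_small_lineMap_pos (P := fun _ => β) c fun _ => hβ
  let p : E := ∑ a, β • ρ.vertex a
  have hβ1 : ∑ _a : Fin (k + 1), β = 1 := sum_inv_card_eq_one k
  have hpτ : p ∈ convexHull ℝ (τ.1 : Set E) :=
    (convex_convexHull ℝ _).sum_mem (fun _ _ => hβ.le) hβ1 fun a _ =>
      subset_convexHull ℝ _ (hρτ (ρ.vertex_mem a))
  have hwτ : τ.vertex j ∈ convexHull ℝ (τ.1 : Set E) := subset_convexHull ℝ _ (τ.vertex_mem j)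
  have hx : AffineMap.lineMap p (τ.vertex j) t ∈ convexHull ℝ (τ.1 : Set E) :=
    (convex_convexHull ℝ _).lineMap_mem hpτ hwτ ⟨ht0.le, ht1.le⟩
  have hx' : AffineMap.lineMap p (τ.vertex j) t ∈ convexHull ℝ (τ'.1 : Set E) := by
    have hexp : AffineMap.lineMap p (τ.vertex j) t =
        ∑ i : Fin (k + 2), (Fin.cons (t * c₀) (fun a => (1 - t) * β + t * c a) : Fin (k + 2) → ℝ) i •
          (Fin.cons (τ'.vertex j') ρ.vertex : Fin (k + 2) → E) i := by
      rw [Fin.sum_univ_succ, AffineMap.lineMap_apply_module, ← hcw]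
      simp only [p, Fin.cons_zero, Fin.cons_succ, add_smul, Finset.sum_add_distrib, smul_add,
        Finset.smul_sum, smul_smul]
      abel
    rw [hexp]
    refine (convex_convexHull ℝ _).sum_mem (fun i _ => ?_) ?_ fun i _ => subset_convexHull ℝ _ ?_
    · refine Fin.cases ?_ (fun a => ?_) i
      · exact mul_nonneg ht0.le hc₀.le
      · simpa using (ht a).le
    · rw [Fin.sum_univ_succ]
      simp only [Fin.cons_zero, Fin.cons_succ, Finset.sum_add_distrib, ← Finset.mul_sum, hβ1]
      linear_combination t * hc1
    · refine Fin.cases ?_ (fun a => ?_) i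
      · exact τ'.vertex_mem j'
      · exact hρτ' (ρ.vertex_mem a)
  obtain ⟨l, h1, h0⟩ := exists_barycentric_coords (M.indep τ.2.1)
  -- The common point lies in the face `τ ∩ τ'`, which omits `τ.vertex j`, yet its coordinate at
  -- that vertex is at least `t > 0`.
  have hzero := coords_eq_zero (ρ := τ.1 ∩ τ'.1) Finset.inter_subset_left h0
    (by rw [Finset.coe_inter]; exact M.inter_subset_convexHull τ.2.1 τ'.2.1 ⟨hx, hx'⟩)
    (τ.vertex_mem j) (fun h => hwτ' (Finset.mem_inter.1 h).2)
  rw [AffineMap.apply_lineMap, AffineMap.lineMap_apply_module, h1 _ (τ.vertex_mem j), smul_eq_mul,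
    smul_eq_mul, mul_one] at hzero
  have := mul_nonneg (sub_nonneg.2 ht1.le) (coords_nonneg h1 h0 hpτ (τ.vertex_mem j))
  linarith

/-- If some point of `σ` lies on a given side of `ρ`, then so does some coface of `ρ` in `σ`. -/
theorem exists_coface_side_mul_pos [Finite M.faces] (hNM : IsSubdivision N M)
    (hρσ : ∀ a, ρ.vertex a ∈ convexHull ℝ (Set.range σ.vertex)) {q : E}
    (hq : q ∈ convexHull ℝ (Set.range σ.vertex)) (hqs : side L ρ.vertex q ≠ 0) :
    ∃ (τ : Simplex M (k + 1)) (j : Fin (k + 2)), τ.face j = ρ ∧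
      (∀ i, τ.vertex i ∈ convexHull ℝ (Set.range σ.vertex)) ∧
      0 < side L ρ.vertex (τ.vertex j) * side L ρ.vertex q := by
  let β : ℝ := ((k : ℝ) + 1)⁻¹
  have hβ : 0 < β := by positivity
  have hβ1 : ∑ _a : Fin (k + 1), β = 1 := sum_inv_card_eq_one k
  let p : E := ∑ a, β • ρ.vertex a
  have hpρ : p ∈ convexHull ℝ (ρ.1 : Set E) := by
    rw [← ρ.range_vertex]
    exact IsCoords.sum_smul_mem hβ1 fun _ => hβ.le
  have hpσ : p ∈ convexHull ℝ (Set.range σ.vertex) :=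
    (convex_convexHull ℝ _).sum_mem (fun _ _ => hβ.le) hβ1 fun a _ => hρσ a
  have hline : ∀ t : ℝ, 0 < t → t ≤ 1 →
      AffineMap.lineMap p q t ∈ convexHull ℝ (σ.1 : Set E) := fun t ht0 ht1 => by
    rw [← σ.range_vertex]
    exact (convex_convexHull ℝ _).lineMap_mem hpσ hq ⟨ht0.le, ht1⟩
  obtain ⟨τ₀, hτ₀, hpτ₀, t, ht0, ht1, w, hw, hw1, hwx⟩ := exists_face_germ M
    (fun t ht0 ht1 => hNM.space_eq.ge (N.convexHull_subset_space σ.2.1 (hline t ht0 ht1)))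
  have hτ₀σ := hNM.subset_convexHull σ.2.1 hτ₀ hw hw1 hwx (hline t ht0 ht1)
  rw [← σ.range_vertex] at hτ₀σ
  -- All coordinates of `p` in `ρ` equal `β > 0`, so `p` lies in no proper face of `ρ`, and `ρ ∩ τ₀`
  -- must be all of `ρ`.
  have hρτ₀ : ρ.1 ⊆ τ₀ := by
    intro y hy
    by_contra hyτ
    obtain ⟨l, h1, h0⟩ := exists_barycentric_coords (M.indep ρ.2.1)
    have hzero := coords_eq_zero (ρ := ρ.1 ∩ τ₀) Finset.inter_subset_left h0
      (by rw [Finset.coe_inter]; exact M.inter_subset_convexHull ρ.2.1 hτ₀ ⟨hpρ, hpτ₀⟩)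
      hy (fun h => hyτ (Finset.mem_inter.1 h).2)
    obtain ⟨a, rfl⟩ := ρ.mem_iff.1 hy
    have hpa := (ρ.isCoords h1 h0).apply_sum hβ1 a
    exact hβ.ne' (hpa.symm.trans hzero)
  have hsum : ∑ y ∈ τ₀, w y * (side L ρ.vertex y * side L ρ.vertex q) =
      t * (side L ρ.vertex q * side L ρ.vertex q) := by
    have hx : side L ρ.vertex (AffineMap.lineMap p q t) = t * side L ρ.vertex q := by
      rw [AffineMap.apply_lineMap, AffineMap.lineMap_apply_module, side_combination_self L ρ hβ1]
      simp
    rw [← hwx, map_sum_of_sum_eq_one _ _ _ _ hw1] at hx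
    simp only [smul_eq_mul] at hx
    rw [← mul_assoc, ← hx, Finset.sum_mul]
    exact Finset.sum_congr rfl fun y _ => (mul_assoc _ _ _).symm
  -- The average over `τ₀` computed in `hsum` is positive, so some vertex of `τ₀` is on the side of
  -- `q`; its join with `ρ` is the coface.
  obtain ⟨y, hy, hypos⟩ : ∃ y ∈ τ₀, 0 < side L ρ.vertex y * side L ρ.vertex q := by
    by_contra! hle
    have h1 : ∑ y ∈ τ₀, w y * (side L ρ.vertex y * side L ρ.vertex q) ≤ 0 :=
      Finset.sum_nonpos fun y hy => mul_nonpos_of_nonneg_of_nonpos (hw y hy).le (hle y hy)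
    have h2 : 0 < t * (side L ρ.vertex q * side L ρ.vertex q) :=
      mul_pos ht0 (mul_self_pos.2 hqs)
    linarith
  have hyρ : y ∉ ρ.1 := fun h => by
    obtain ⟨a, rfl⟩ := ρ.mem_iff.1 h
    rw [side_apply_self, zero_mul] at hypos
    exact lt_irrefl _ hypos
  have hins : insert y ρ.1 ⊆ τ₀ := Finset.insert_subset hy hρτ₀
  obtain ⟨τ, j, hτ, hj, hjy⟩ := ρ.exists_coface hyρ
    (M.down_closed hτ₀ hins (Finset.insert_nonempty _ _))
  refine ⟨τ, j, hj, fun i => hτ₀σ (hins ?_), hjy ▸ hypos⟩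
  rw [← hτ]
  exact τ.vertex_mem i

theorem side_vertex (hL : IsCoords σ.vertex L) (i : Fin (k + 2)) :
    side L ρ.vertex (σ.vertex i) = (-1 : ℝ) ^ (i : ℕ) *
      (Matrix.of fun a b => L (i.succAbove b) (ρ.vertex a)).det := by
  rw [side_apply, Finset.sum_eq_single i]
  · rw [hL, if_pos rfl, one_mul]
  · intro i' _ hi'
    rw [hL, if_neg hi', zero_mul]
  · simp

/-- In the facet opposite vertex `i` the coordinate `L i` vanishes, so every minor retaining that
column is zero and only the `i`-th term survives. -/
theorem side_eq_of_mem_face (hL : IsCoords σ.vertex L) {i : Fin (k + 2)}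
    (hi : ∀ a, ρ.vertex a ∈ convexHull ℝ (Set.range (σ.face i).vertex)) (x : E) :
    side L ρ.vertex x = L i x * side L ρ.vertex (σ.vertex i) := by
  rw [side_vertex hL, side_apply, Finset.sum_eq_single i]
  · intro i' _ hi'
    obtain ⟨c, hc⟩ := Fin.exists_succAbove_eq hi'.symm
    rw [Matrix.det_eq_zero_of_column_eq_zero c, mul_zero, mul_zero]
    intro a
    rw [Matrix.of_apply, hc, hL.apply_eq_zero_of_mem_face (hi a)]
  · simp

theorem side_vertex_ne_zero_of_mem_face (hL : IsCoords σ.vertex L) {i : Fin (k + 2)}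
    (hi : ∀ a, ρ.vertex a ∈ convexHull ℝ (Set.range (σ.face i).vertex)) :
    side L ρ.vertex (σ.vertex i) ≠ 0 := by
  rw [side_vertex hL]
  exact mul_ne_zero (pow_ne_zero _ (by norm_num))
    (det_ne_zero_of_linearIndependent ((hL.face i).linearIndependent ρ.affineIndependent hi))

/-- The `k + 1` independent coordinate rows of `ρ` extend to a basis of a `(k + 2)`-dimensional
space; the nonzero determinant has a nonzero cofactor along the added row. -/
theorem exists_side_vertex_ne_zero (hL : IsCoords σ.vertex L)
    (hρσ : ∀ a, ρ.vertex a ∈ convexHull ℝ (Set.range σ.vertex)) :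
    ∃ i, side L ρ.vertex (σ.vertex i) ≠ 0 := by
  have hli := hL.linearIndependent ρ.affineIndependent hρσ
  obtain ⟨v, hv⟩ : ∃ v : Fin (k + 2) → ℝ,
      v ∉ Submodule.span ℝ (Set.range fun a i => L i (ρ.vertex a)) := by
    by_contra! h
    have htop := Submodule.eq_top_iff'.2 h
    have h1 := finrank_range_le_card (R := ℝ) fun (a : Fin (k + 1)) i => L i (ρ.vertex a)
    rw [Set.finrank, htop, finrank_top] at h1
    simp at h1
  have hcons := det_ne_zero_of_linearIndependent (linearIndependent_finCons.2 ⟨hli, hv⟩)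
  by_contra! h
  refine hcons ?_
  rw [Matrix.det_succ_row_zero]
  refine Finset.sum_eq_zero fun i _ => ?_
  have hi := h i
  rw [side_vertex hL] at hi
  rw [mul_right_comm]
  exact mul_eq_zero_of_left hi _

end Side

/-- The left side is the sum, over cofaces of `ρ` in `σ`, of the signs of their sides. Outside `σ`
both sides vanish. In a facet of `σ` there is one coface, with the sign of the facet; in no facet
there are two, with opposite signs, and the right side is zero. -/
theorem boundary_inclusion_single [Finite M.faces] (hNM : IsSubdivision N M) {k : ℕ}
    (σ : Simplex N (k + 1)) (ρ : Simplex M k) :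
    boundary M k (inclusion N M (k + 1) (Finsupp.single σ 1)) ρ =
      ∑ i : Fin (k + 2), (-1 : ℝ) ^ (i : ℕ) * orientationSign (σ.face i) ρ := by
  classical
  have := Fintype.ofFinite (Simplex M (k + 1))
  obtain ⟨L, hL⟩ := σ.exists_isCoords
  rw [boundary_apply, ← Fintype.sum_prod_type']
  simp only [inclusion_single_apply]
  by_cases hρσ : ∀ a, ρ.vertex a ∈ convexHull ℝ (Set.range σ.vertex)
  swap
  · rw [Finset.sum_eq_zero, Finset.sum_eq_zero]
    · refine fun i _ => ?_
      rw [orientationSign_eq_zero' fun h => hρσ fun a => convexHull_mono ?_ (h a), mul_zero]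
      rintro _ ⟨c, rfl⟩
      exact ⟨_, (σ.face_vertex i c).symm⟩
    · rintro ⟨τ, j⟩ -
      simp only
      split_ifs with hj
      · rw [orientationSign_eq_zero' fun h => hρσ fun a => ?_, mul_zero]
        rw [← hj, τ.face_vertex]
        exact h _
      · rfl
  have hother : ∀ (τ : Simplex M (k + 1)) (j : Fin (k + 2)),
      (τ.face j = ρ → (∀ i, τ.vertex i ∈ convexHull ℝ (Set.range σ.vertex)) →
        side L ρ.vertex (τ.vertex j) = 0) →
      (if τ.face j = ρ then (-1 : ℝ) ^ (j : ℕ) * orientationSign σ τ else 0) = 0 := by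
    intro τ j h
    split_ifs with hj
    · by_cases hτ : ∀ i, τ.vertex i ∈ convexHull ℝ (Set.range σ.vertex)
      · rw [neg_one_pow_mul_orientationSign hL hj hτ, h hj hτ, Real.sign_zero]
      · rw [orientationSign_eq_zero' hτ, mul_zero]
    · rfl
  have hvert : ∀ i, σ.vertex i ∈ convexHull ℝ (Set.range σ.vertex) := fun i =>
    subset_convexHull ℝ _ (Set.mem_range_self i)
  by_cases hface : ∃ i, ∀ a, ρ.vertex a ∈ convexHull ℝ (Set.range (σ.face i).vertex)
  · -- `ρ` lies in a facet of `σ`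
    obtain ⟨i, hi⟩ := hface
    have hne := side_vertex_ne_zero_of_mem_face hL hi
    obtain ⟨τ, j, hj, hτ, hpos⟩ := exists_coface_side_mul_pos hNM hρσ (hvert i) hne
    rw [Finset.sum_eq_single (τ, j), Finset.sum_eq_single i]
    · simp only
      rw [if_pos hj, neg_one_pow_mul_orientationSign hL hj hτ, orientationSign_eq_sign (hL.face i) hi,
        neg_one_pow_mul_sign, ← side_vertex hL]
      rcases pos_and_pos_or_neg_and_neg_of_mul_pos hpos with h | h
      · rw [Real.sign_of_pos h.1, Real.sign_of_pos h.2]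
      · rw [Real.sign_of_neg h.1, Real.sign_of_neg h.2]
    · intro i' _ hi'
      rw [orientationSign_eq_zero', mul_zero]
      intro h
      refine hne ?_
      rw [side_eq_of_mem_face hL h, hL, if_neg hi', zero_mul]
    · simp
    · rintro ⟨τ', j'⟩ - hne'
      refine hother τ' j' fun hj' hτ' => ?_
      by_contra hs
      refine hne' (Prod.ext_iff.2 (eq_of_side_mul_pos hL hj' hj hτ' hτ ?_))
      -- Since `L i ≥ 0` on `σ`, all of `σ` lies weakly on the side of vertex `i`, so any further
      -- coface would share the side of `τ`.
      have h1 := side_eq_of_mem_face hL hi (τ'.vertex j')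
      have h2 : 0 < L i (τ'.vertex j') :=
        lt_of_le_of_ne (hL.nonneg (hτ' j') i) fun h => hs (by rw [h1, ← h, zero_mul])
      rw [h1, mul_assoc, mul_comm (side L ρ.vertex (σ.vertex i))]
      exact mul_pos h2 hpos
    · simp
  · -- `ρ` meets the interior of `σ`
    push Not at hface
    obtain ⟨i, hne⟩ := exists_side_vertex_ne_zero hL hρσ
    let β : ℝ := ((k : ℝ) + 1)⁻¹
    have hβ : 0 < β := by positivity
    have hβ1 : ∑ _a : Fin (k + 1), β = 1 := sum_inv_card_eq_one k
    let p : E := ∑ a, β • ρ.vertex a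
    have hpσ : p ∈ convexHull ℝ (Set.range σ.vertex) :=
      (convex_convexHull ℝ _).sum_mem (fun _ _ => hβ.le) hβ1 fun a _ => hρσ a
    have hp : ∀ c, 0 < L c p := by
      intro c
      rw [map_sum_of_sum_eq_one _ _ _ _ hβ1]
      obtain ⟨a, ha⟩ := hface c
      refine Finset.sum_pos' (fun a _ => mul_nonneg hβ.le (hL.nonneg (hρσ a) c))
        ⟨a, Finset.mem_univ a, mul_pos hβ (lt_of_le_of_ne (hL.nonneg (hρσ a) c) fun h => ?_)⟩
      exact ha (hL.mem_face_of_apply_eq_zero (hρσ a) h.symm)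
    -- The point `q = p + t (p - σ.vertex i)` lies on the side opposite to vertex `i`. It stays in
    -- `σ` for small `t`, because `p` has positive coordinates when `ρ` lies in no facet.
    obtain ⟨t, ht0, -, ht⟩ := exists_small_lineMap_pos
      (fun c => 2 * L c p - L c (σ.vertex i)) hp
    have hW1 : ∑ c, ((1 - t) * L c p + t * (2 * L c p - L c (σ.vertex i))) = 1 := by
      simp only [Finset.sum_add_distrib, ← Finset.mul_sum, Finset.sum_sub_distrib,
        hL.sum_eq_one hpσ, hL.sum_eq_one (hvert i)]
      ring
    let q : E := ∑ c, ((1 - t) * L c p + t * (2 * L c p - L c (σ.vertex i))) • σ.vertex c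
    have hq : q ∈ convexHull ℝ (Set.range σ.vertex) :=
      IsCoords.sum_smul_mem hW1 fun c => (ht c).le
    have hqs : side L ρ.vertex q = -t * side L ρ.vertex (σ.vertex i) := by
      have hps : side L ρ.vertex p = 0 := side_combination_self L ρ hβ1
      rw [side_apply] at hps ⊢
      rw [side_apply, Finset.sum_congr rfl fun c _ => by rw [hL.apply_sum hW1 c]]
      simp only [add_mul, mul_assoc, sub_mul, Finset.sum_add_distrib, ← Finset.mul_sum,
        Finset.sum_sub_distrib, hps]
      ring
    obtain ⟨τ, j, hj, hτ, hpos⟩ := exists_coface_side_mul_pos hNM hρσ (hvert i) hne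
    obtain ⟨τ', j', hj', hτ', hpos'⟩ := exists_coface_side_mul_pos hNM hρσ hq
      (by rw [hqs]; exact mul_ne_zero (neg_ne_zero.2 ht0.ne') hne)
    have hneg : side L ρ.vertex (τ'.vertex j') * side L ρ.vertex (σ.vertex i) < 0 := by
      rw [hqs] at hpos'
      nlinarith
    have hsgn : side L ρ.vertex (τ.vertex j) * side L ρ.vertex (τ'.vertex j') < 0 := by
      have h1 : side L ρ.vertex (τ.vertex j) * side L ρ.vertex (τ'.vertex j') *
          (side L ρ.vertex (σ.vertex i) * side L ρ.vertex (σ.vertex i)) < 0 := by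
        have := mul_neg_of_pos_of_neg hpos hneg
        linarith
      by_contra! hge
      exact absurd (mul_nonneg hge (mul_self_nonneg _)) h1.not_ge
    rw [Fintype.sum_eq_add (τ, j) (τ', j'), Finset.sum_eq_zero]
    · simp only
      rw [if_pos hj, if_pos hj', neg_one_pow_mul_orientationSign hL hj hτ,
        neg_one_pow_mul_orientationSign hL hj' hτ']
      rcases mul_neg_iff.1 hsgn with h | h
      · rw [Real.sign_of_pos h.1, Real.sign_of_neg h.2, add_neg_cancel]
      · rw [Real.sign_of_neg h.1, Real.sign_of_pos h.2, neg_add_cancel]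
    · refine fun c _ => ?_
      rw [orientationSign_eq_zero', mul_zero]
      intro h
      obtain ⟨a, ha⟩ := hface c
      exact ha (h a)
    · intro h
      obtain ⟨rfl, rfl⟩ := Prod.ext_iff.1 h
      exact absurd hsgn (mul_self_nonneg _).not_gt
    · rintro ⟨τ₁, j₁⟩ ⟨h1, h2⟩
      refine hother τ₁ j₁ fun hj₁ hτ₁ => ?_
      by_contra hs
      rcases lt_or_gt_of_ne (mul_ne_zero hs (left_ne_zero_of_mul hsgn.ne)) with h | h
      · refine h2 (Prod.ext_iff.2 (eq_of_side_mul_pos hL hj₁ hj' hτ₁ hτ' ?_))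
        have h3 := mul_pos_of_neg_of_neg h hsgn
        have h4 : 0 < side L ρ.vertex (τ₁.vertex j₁) * side L ρ.vertex (τ'.vertex j') *
            (side L ρ.vertex (τ.vertex j) * side L ρ.vertex (τ.vertex j)) := by linarith
        exact lt_of_mul_lt_mul_right (by rwa [zero_mul]) (mul_self_nonneg _)
      · exact h1 (Prod.ext_iff.2 (eq_of_side_mul_pos hL hj₁ hj hτ₁ hτ h))

/-- The map induced by a subdivision is a chain map. -/
theorem boundary_inclusion [Finite M.faces] (hNM : IsSubdivision N M) (k : ℕ)
    (x : Chain N (k + 1)) :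
    boundary M k (inclusion N M (k + 1) x) = inclusion N M k (boundary N k x) := by
  suffices h : boundary M k ∘ₗ inclusion N M (k + 1) = inclusion N M k ∘ₗ boundary N k from
    LinearMap.congr_fun h x
  refine Finsupp.lhom_ext' fun σ => LinearMap.ext_ring (Finsupp.ext fun ρ => ?_)
  simp only [LinearMap.comp_apply, Finsupp.lsingle_apply]
  rw [boundary_inclusion_single hNM, boundary_single, map_sum, Finsupp.finsetSum_apply]
  refine Finset.sum_congr rfl fun i _ => ?_
  rw [map_smul, Finsupp.smul_apply, inclusion_single_apply, smul_eq_mul]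

end InclusionChainMap

end SubdivisionHarmonic

theorem corollary2p4 {E : Type*} [AddCommGroup E] [Module ℝ E] [LinearOrder E]
    (N M : Geometry.SimplicialComplex ℝ E) [Finite N.faces] [Finite M.faces]
    (hNM : SubdivisionHarmonic.IsSubdivision N M)
    (h : SubdivisionHarmonic.ChainInner N) (g : SubdivisionHarmonic.ChainInner M) :
    ∃ V : ∀ k, Submodule ℝ (SubdivisionHarmonic.Chain M k),
      SubdivisionHarmonic.IsComplementFamily N M g V ∧
      (∀ V' : ∀ k, Submodule ℝ (SubdivisionHarmonic.Chain M k),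
        SubdivisionHarmonic.IsComplementFamily N M g V' → V' = V) ∧
      ∃ g' : SubdivisionHarmonic.ChainInner M,
        SubdivisionHarmonic.IsCanonical N M h g V g' ∧
        (∀ g'' : SubdivisionHarmonic.ChainInner M,
          SubdivisionHarmonic.IsCanonical N M h g V g'' → g'' = g') ∧
        (∀ (k : ℕ) (x y : SubdivisionHarmonic.Chain N k),
          (g' k).form (SubdivisionHarmonic.inclusion N M k x)
            (SubdivisionHarmonic.inclusion N M k y) = (h k).form x y) ∧
        (∀ k : ℕ,
          SubdivisionHarmonic.inclusion N M k ∘ₗ SubdivisionHarmonic.laplacian N h k =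
            SubdivisionHarmonic.laplacian M g' k ∘ₗ SubdivisionHarmonic.inclusion N M k) := by
  have hcomm := SubdivisionHarmonic.boundary_inclusion hNM
  exact SubdivisionHarmonic.exists_canonical_of_acyclic_cokernel h g
    (fun k c => SubdivisionHarmonic.boundary_boundary c) hcomm
    (SubdivisionHarmonic.inclusion_injective hNM hcomm)
    (SubdivisionHarmonic.exists_eq_inclusion_add_boundary hNM hcomm)
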